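/- Let $\mathbb F=\mathbb R$ or $\mathbb C$, let $m,n\ge 2$ be integers with $(m,n)\neq(2,2)$, and let $M_{m,n}(\mathbb F)$ be the space of $m\times n$ matrices over $\mathbb F$ with the spectral norm $\|A\|=\max\{\|Ax\|_2 : x\in\mathbb F^n,\ \|x\|_2=1\}$. Call a pair $A,B\in M_{m,n}(\mathbb F)$ *parallel* if $\|A+\mu B\|=\|A\|+\|B\|$ for some $\mu\in\mathbb F$ with $|\mu|=1$, and a *TEA pair* (triangle equality attaining) if $\|A+B\|=\|A\|+\|B\|$. A map $T$ *preserves* parallel (respectively TEA) pairs if $T(A),T(B)$ is a parallel (respectively TEA) pair whenever $A,B$ is. Let $U_k(\mathbb F)$ denote the group of $k\times k$ unitary matrices if $\mathbb F=\mathbb C$, and of $k\times k$ real orthogonal matrices if $\mathbb F=\mathbb R$. Let $T:M_{m,n}(\mathbb F)\to M_{m,n}(\mathbb F)$ be a nonzero $\mathbb F$-linear map. The following conditions are equivalent. (a) $T$ preserves TEA pairs. (b) $T$ preserves parallel pairs and the range space of $T$ has dimension larger than one. (c) There are $U\in U_m(\mathbb F)$, $V\in U_n(\mathbb F)$ and $\gamma>0$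 such that either $T(A)=\gamma UAV$ for all $A$, or $m=n$ and $T(A)=\gamma UA^{\mathrm t}V$ for all $A$. -/

import Mathlib

-- `‖A‖` for a matrix `A` is the spectral norm: the operator norm of `x ↦ A x` between
-- Euclidean spaces.
open scoped Matrix.Norms.L2Operator

namespace MatrixPairs

variable {𝕜 : Type*} [RCLike 𝕜] {m n : ℕ}

/-- `A` and `B` attain the triangle equality for the spectral norm. -/
def IsTEA (A B : Matrix (Fin m) (Fin n) 𝕜) : Prop :=
  ‖A + B‖ = ‖A‖ + ‖B‖

/-- `A` and `B` are parallel for the spectral norm. -/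
def IsParallel (A B : Matrix (Fin m) (Fin n) 𝕜) : Prop :=
  ∃ μ : 𝕜, ‖μ‖ = 1 ∧ ‖A + μ • B‖ = ‖A‖ + ‖B‖

/-- `T` sends TEA pairs to TEA pairs. -/
def PreservesTEA (T : Matrix (Fin m) (Fin n) 𝕜 →ₗ[𝕜] Matrix (Fin m) (Fin n) 𝕜) : Prop :=
  ∀ A B, IsTEA A B → IsTEA (T A) (T B)

/-- `T` sends parallel pairs to parallel pairs. -/
def PreservesParallel (T : Matrix (Fin m) (Fin n) 𝕜 →ₗ[𝕜] Matrix (Fin m) (Fin n) 𝕜) : Prop :=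
  ∀ A B, IsParallel A B → IsParallel (T A) (T B)

end MatrixPairs

/-! Two operators are parallel exactly when their norms are attained at a common unit pair `(x, y)`,
meaning `|⟪x, A y⟫| = ‖A‖`. The operators attaining at `(x, y)` form a face: the sums `β • rankOne 𝕜
x y + X` with `X ∈ block x y` and `‖X‖ ≤ ‖β‖`. By compactness a parallel-preserving `T` sends each
face into a face, say at `(u, v)` (`exists_carries`). So on each face `‖T A‖` is the absolute value
of one linear functional `⟪u, T A v⟫`, and the proof exploits this rigidity.

Injectivity is the main difficulty. If `T` kills `rankOne 𝕜 x y + X` with `‖X‖ < 1`, then `T` has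
rank at most one on `aligned x y` (`Thin`). Thinness at a pair whose rank one operator is not killed
spreads to the whole space, against the hypothesis on the range; hence rank one operators are not
killed and no pair is thin. A kernel element of least rank is then excluded by comparing `‖T ·‖` on
the faces of three of its singular pairs (`injective_of_parallel`). These arguments need a vector
orthogonal to two given ones, on one side at least; this is where size 2×2 is lost.

An injective `T` maps `aligned x y` onto `aligned u v` and carries orthogonal pairs to orthogonal
pairs. Up to scalars, `rankOne 𝕜 x y` is the only operator aligned with all pairs orthogonal to `(x,
y)`, so `T` preserves rank one operators and their orthogonality. The classical rank one preserver
argument gives `P A Q` or `P Aᵀ Q`, and preservation of orthogonality makes `P` and `Q` multiples of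
unitaries.

For TEA pairs, absorbing the phase into `B` gives preservation of parallel pairs, and a scalar
functional preserving triangle equality is zero, so the range is not a line. Conversely, the maps of
the final form multiply the norm by a constant. -/

namespace ParallelPairs

set_option linter.unusedSectionVars false

open InnerProductSpace Filter Topology

/-! ### Pairs of vectors and their aligned operators -/

variable {𝕜 E F : Type*} [RCLike 𝕜]
  [NormedAddCommGroup E] [InnerProductSpace 𝕜 E] [FiniteDimensional 𝕜 E]
  [NormedAddCommGroup F] [InnerProductSpace 𝕜 F] [FiniteDimensional 𝕜 F]

local notation "⟪" x "," y "⟫" => inner 𝕜 x y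

/-- Parallelism of operators for the operator norm. -/
def Parallel (A B : E →L[𝕜] F) : Prop :=
  ∃ μ : 𝕜, ‖μ‖ = 1 ∧ ‖A + μ • B‖ = ‖A‖ + ‖B‖

/-- The norm of `A` is attained by the pair of vectors `(x, y)`. -/
def Attains (x : F) (y : E) (A : E →L[𝕜] F) : Prop :=
  ‖⟪x, A y⟫‖ = ‖A‖

/-- The operators that annihilate `y` and whose range is orthogonal to `x`. -/
def block (x : F) (y : E) : Submodule 𝕜 (E →L[𝕜] F) where
  carrier := {X | X y = 0 ∧ ∀ z, ⟪x, X z⟫ = 0}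
  zero_mem' := by simp
  add_mem' := by
    rintro A B ⟨h1, h2⟩ ⟨h3, h4⟩
    exact ⟨by simp [h1, h3], fun z => by simp [inner_add_right, h2, h4]⟩
  smul_mem' := by
    rintro c A ⟨h1, h2⟩
    exact ⟨by simp [h1], fun z => by simp [inner_smul_right, h2]⟩

/-- The operators having `(x, y)` as a pair of singular vectors. -/
def aligned (x : F) (y : E) : Submodule 𝕜 (E →L[𝕜] F) where
  carrier := {A | (∃ c : 𝕜, A y = c • x) ∧ ∀ z, ⟪y, z⟫ = 0 → ⟪x, A z⟫ = 0}
  zero_mem' := ⟨⟨0, by simp⟩, by simp⟩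
  add_mem' := by
    rintro A B ⟨⟨a, h1⟩, h2⟩ ⟨⟨b, h3⟩, h4⟩
    exact ⟨⟨a + b, by simp [h1, h3, add_smul]⟩, fun z hz => by
      simp [inner_add_right, h2 z hz, h4 z hz]⟩
  smul_mem' := by
    rintro c A ⟨⟨a, h1⟩, h2⟩
    exact ⟨⟨c * a, by simp [h1, mul_smul]⟩, fun z hz => by simp [inner_smul_right, h2 z hz]⟩

theorem mem_block {x : F} {y : E} {X : E →L[𝕜] F} :
    X ∈ block x y ↔ X y = 0 ∧ ∀ z, ⟪x, X z⟫ = 0 := Iff.rfl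

theorem mem_aligned {x : F} {y : E} {A : E →L[𝕜] F} :
    A ∈ aligned x y ↔ (∃ c : 𝕜, A y = c • x) ∧ ∀ z, ⟪y, z⟫ = 0 → ⟪x, A z⟫ = 0 := Iff.rfl

theorem rankOne_mem_block {x z : F} {y w : E} (hx : ⟪x, z⟫ = 0) (hy : ⟪y, w⟫ = 0) :
    rankOne 𝕜 z w ∈ block x y := by
  refine ⟨by simp [inner_eq_zero_symm.1 hy], fun t => by simp [inner_smul_right, hx]⟩

theorem block_le_aligned (x : F) (y : E) : block (𝕜 := 𝕜) x y ≤ aligned x y :=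
  fun _ h => ⟨⟨0, by simp [h.1]⟩, fun z _ => h.2 z⟩

theorem rankOne_mem_aligned (x : F) (y : E) : rankOne 𝕜 x y ∈ aligned x y :=
  ⟨⟨⟪y, y⟫, rfl⟩, fun z hz => by simp [hz]⟩

theorem aligned_smul {x : F} {y : E} {a b : 𝕜} (ha : a ≠ 0) (hb : b ≠ 0) :
    aligned (𝕜 := 𝕜) (a • x) (b • y) = aligned x y := by
  ext A
  simp only [mem_aligned, map_smul, inner_smul_left, mul_eq_zero, map_eq_zero, ha, hb, false_or]
  refine and_congr_left fun _ => ⟨?_, ?_⟩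
  · rintro ⟨c, hc⟩
    exact ⟨b⁻¹ * c * a, by rw [mul_assoc, mul_smul, mul_smul, ← hc, smul_smul,
      inv_mul_cancel₀ hb, one_smul]⟩
  · rintro ⟨c, hc⟩
    exact ⟨b * c * a⁻¹, by rw [hc, smul_smul, smul_smul, mul_assoc, mul_assoc,
      inv_mul_cancel₀ ha, mul_one]⟩

theorem block_smul {x : F} {y : E} {a b : 𝕜} (ha : a ≠ 0) (hb : b ≠ 0) :
    block (𝕜 := 𝕜) (a • x) (b • y) = block x y := by
  ext A
  simp [mem_block, inner_smul_left, ha, hb]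

theorem exists_aligned_decomp {x : F} {y : E} (hy : y ≠ 0) {A : E →L[𝕜] F}
    (hA : A ∈ aligned x y) : ∃ β : 𝕜, ∃ X ∈ block x y, A = β • rankOne 𝕜 x y + X := by
  obtain ⟨⟨c, hc⟩, h⟩ := hA
  have hyy : ⟪y, y⟫ ≠ 0 := inner_self_ne_zero.2 hy
  refine ⟨c / ⟪y, y⟫, A - (c / ⟪y, y⟫) • rankOne 𝕜 x y, ⟨?_, fun z => ?_⟩, by simp⟩
  · rw [sub_apply, smul_apply, rankOne_apply, smul_smul, div_mul_cancel₀ _ hyy, hc, sub_self]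
  · have h1 := h (z - (⟪y, z⟫ / ⟪y, y⟫) • y) (by
      rw [inner_sub_right, inner_smul_right, div_mul_cancel₀ _ hyy, sub_self])
    rw [map_sub, map_smul, hc, inner_sub_right, inner_smul_right, inner_smul_right] at h1
    simp only [sub_apply, smul_apply, rankOne_apply,
      inner_sub_right, inner_smul_right]
    rw [← h1]; ring

/-! ### Norm attainment and parallelism -/

section Norm

variable {x u : F} {y v : E} {A B X : E →L[𝕜] F}

theorem norm_inner_apply_le (hx : ‖x‖ = 1) (hy : ‖y‖ = 1) (A : E →L[𝕜] F) :
    ‖⟪x, A y⟫‖ ≤ ‖A‖ := by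
  have h1 := norm_inner_le_norm (𝕜 := 𝕜) x (A y)
  have h2 := A.le_opNorm y
  rw [hx, one_mul] at h1; rw [hy, mul_one] at h2
  exact h1.trans h2

theorem eq_inner_smul_of_norm_le {u w : F} (hu : ‖u‖ = 1) (h : ‖w‖ ≤ ‖⟪u, w⟫‖) :
    w = ⟪u, w⟫ • u := by
  have h1 : ‖⟪u, w⟫‖ = ‖u‖ * ‖w‖ := le_antisymm (norm_inner_le_norm _ _) (by simpa [hu] using h)
  have hu0 : u ≠ 0 := by rintro rfl; simp at hu
  by_cases hw : w = 0
  · simp [hw]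
  obtain ⟨r, -, rfl⟩ := (norm_inner_eq_norm_iff hu0 hw).1 h1
  simp [inner_smul_right, inner_self_eq_norm_sq_to_K, hu]

theorem Attains.apply_eq (hx : ‖x‖ = 1) (hy : ‖y‖ = 1) (h : Attains x y A) :
    A y = ⟪x, A y⟫ • x := by
  refine eq_inner_smul_of_norm_le hx ?_
  rw [h]
  simpa [hy] using A.le_opNorm y

/-- Equality in Cauchy–Schwarz makes `A y` a multiple of `x`; the same for the adjoint, which
attains its norm at `(y, x)`, gives the other condition. -/
theorem Attains.mem_aligned (hx : ‖x‖ = 1) (hy : ‖y‖ = 1) (h : Attains x y A) :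
    A ∈ aligned x y := by
  refine ⟨⟨_, h.apply_eq hx hy⟩, fun z hz => ?_⟩
  have := FiniteDimensional.complete 𝕜 E
  have := FiniteDimensional.complete 𝕜 F
  have h' : Attains y x (ContinuousLinearMap.adjoint A) := by
    unfold Attains at *
    rw [LinearIsometryEquiv.norm_map, ContinuousLinearMap.adjoint_inner_right, ← norm_inner_symm, h]
  rw [← ContinuousLinearMap.adjoint_inner_left, h'.apply_eq hy hx, inner_smul_left, hz, mul_zero]

/-- Pythagoras in the source and in the target: the two summands have orthogonal supports and
orthogonal ranges. -/
theorem norm_smul_rankOne_add_le (hx : ‖x‖ = 1) (hy : ‖y‖ = 1) {β : 𝕜} (hX : X ∈ block x y)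
    (hβ : ‖X‖ ≤ ‖β‖) : ‖β • rankOne 𝕜 x y + X‖ ≤ ‖β‖ := by
  refine ContinuousLinearMap.opNorm_le_bound _ (norm_nonneg _) fun z => ?_
  have hyy : ⟪y, y⟫ = 1 := by simp [inner_self_eq_norm_sq_to_K, hy]
  set w := z - ⟪y, z⟫ • y with hw
  have hyw : ⟪y, w⟫ = 0 := by rw [hw, inner_sub_right, inner_smul_right, hyy, mul_one, sub_self]
  have hz : z = ⟪y, z⟫ • y + w := by simp [hw]
  have h1 : ‖z‖ * ‖z‖ = ‖⟪y, z⟫‖ * ‖⟪y, z⟫‖ + ‖w‖ * ‖w‖ := by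
    conv_lhs => rw [hz]
    rw [norm_add_sq_eq_norm_sq_add_norm_sq_of_inner_eq_zero (𝕜 := 𝕜) _ _ (by rw [inner_smul_left, hyw, mul_zero]),
      norm_smul, hy, mul_one]
  have hXz : X z = X w := by rw [hw, map_sub, map_smul, hX.1, smul_zero, sub_zero]
  have h2 : ‖(β • rankOne 𝕜 x y + X) z‖ * ‖(β • rankOne 𝕜 x y + X) z‖
      = (‖β‖ * ‖⟪y, z⟫‖) * (‖β‖ * ‖⟪y, z⟫‖) + ‖X w‖ * ‖X w‖ := by
    rw [add_apply, hXz, norm_add_sq_eq_norm_sq_add_norm_sq_of_inner_eq_zero (𝕜 := 𝕜)]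
    · simp [norm_smul, hx]
    · simp [inner_smul_left, hX.2]
  have h3 : ‖X w‖ ≤ ‖β‖ * ‖w‖ := (X.le_opNorm w).trans (by gcongr)
  refine abs_le_of_sq_le_sq' ?_ (by positivity) |>.2
  have h4 : ‖X w‖ * ‖X w‖ ≤ (‖β‖ * ‖w‖) * (‖β‖ * ‖w‖) := by gcongr
  calc _ = _ := pow_two _
    _ = _ := h2
    _ ≤ (‖β‖ * ‖⟪y, z⟫‖) * (‖β‖ * ‖⟪y, z⟫‖) + (‖β‖ * ‖w‖) * (‖β‖ * ‖w‖) := by gcongr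
    _ = ‖β‖ * ‖β‖ * (‖z‖ * ‖z‖) := by rw [h1]; ring
    _ = _ := by ring

theorem inner_smul_rankOne_add_apply (hx : ‖x‖ = 1) (hy : ‖y‖ = 1) (β : 𝕜) (hX : X ∈ block x y) :
    ⟪x, (β • rankOne 𝕜 x y + X) y⟫ = β := by
  simp [hX.1, inner_smul_right, inner_self_eq_norm_sq_to_K, hx, hy]

theorem attains_smul_rankOne_add (hx : ‖x‖ = 1) (hy : ‖y‖ = 1) {β : 𝕜} (hX : X ∈ block x y)
    (hβ : ‖X‖ ≤ ‖β‖) : Attains x y (β • rankOne 𝕜 x y + X) := by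
  refine le_antisymm (norm_inner_apply_le hx hy _) ?_
  rw [inner_smul_rankOne_add_apply hx hy β hX]
  exact norm_smul_rankOne_add_le hx hy hX hβ

theorem attains_rankOne_add (hx : ‖x‖ = 1) (hy : ‖y‖ = 1) (hX : X ∈ block x y)
    (h : ‖X‖ ≤ 1) : Attains x y (rankOne 𝕜 x y + X) := by
  simpa using attains_smul_rankOne_add (β := 1) hx hy hX (by simpa using h)

theorem Attains.norm_block_le (hx : ‖x‖ = 1) (hy : ‖y‖ = 1) {β : 𝕜} (hX : X ∈ block x y)
    (h : Attains x y (β • rankOne 𝕜 x y + X)) : ‖X‖ ≤ ‖β‖ := by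
  have h1 : ‖β • rankOne 𝕜 x y + X‖ = ‖β‖ := by
    rw [← h, inner_smul_rankOne_add_apply hx hy β hX]
  have hyy : ⟪y, y⟫ = 1 := by simp [inner_self_eq_norm_sq_to_K, hy]
  refine ContinuousLinearMap.opNorm_le_bound _ (norm_nonneg _) fun z => ?_
  set w := z - ⟪y, z⟫ • y with hw
  have hyw : ⟪y, w⟫ = 0 := by rw [hw, inner_sub_right, inner_smul_right, hyy, mul_one, sub_self]
  have hXz : X z = (β • rankOne 𝕜 x y + X) w := by
    rw [add_apply, smul_apply, rankOne_apply, hyw, zero_smul, smul_zero, zero_add, hw, map_sub,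
      map_smul, hX.1, smul_zero, sub_zero]
  have h2 : ‖w‖ ≤ ‖z‖ := by
    have hz : z = ⟪y, z⟫ • y + w := by simp [hw]
    have h3 := norm_add_sq_eq_norm_sq_add_norm_sq_of_inner_eq_zero (𝕜 := 𝕜) (⟪y, z⟫ • y) w
      (by rw [inner_smul_left, hyw, mul_zero])
    rw [← hz] at h3
    nlinarith [norm_nonneg z, norm_nonneg w, mul_self_nonneg ‖⟪y, z⟫ • y‖]
  rw [hXz, ← h1]
  exact (ContinuousLinearMap.le_opNorm _ _).trans (by gcongr)

theorem exists_attains [Nontrivial E] [Nontrivial F] (A : E →L[𝕜] F) :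
    ∃ x : F, ∃ y : E, ‖x‖ = 1 ∧ ‖y‖ = 1 ∧ Attains x y A := by
  have := FiniteDimensional.proper 𝕜 E
  let _ : NormedSpace ℝ E := NormedSpace.restrictScalars ℝ 𝕜 E
  let _ : NormedSpace ℝ F := NormedSpace.restrictScalars ℝ 𝕜 F
  obtain ⟨y, hy, hmax⟩ := (isCompact_sphere (0 : E) 1).exists_isMaxOn
    (NormedSpace.sphere_nonempty.2 zero_le_one) (f := fun y => ‖A y‖) (by fun_prop)
  have hy1 : ‖y‖ = 1 := by simpa using hy
  have hA : ‖A y‖ = ‖A‖ := by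
    refine le_antisymm (by simpa [hy1] using A.le_opNorm y) ?_
    refine ContinuousLinearMap.opNorm_le_of_unit_norm (norm_nonneg _) fun z hz => ?_
    exact hmax (by simpa using hz)
  by_cases h0 : A y = 0
  · obtain ⟨x, hx⟩ := exists_norm_eq F zero_le_one
    exact ⟨x, y, hx, hy1, by rw [Attains, h0, ← hA, h0]; simp⟩
  · have hn : ‖A y‖ ≠ 0 := norm_ne_zero_iff.2 h0
    refine ⟨((‖A y‖⁻¹ : ℝ) : 𝕜) • A y, y, by simp [norm_smul, hn], hy1, ?_⟩
    rw [Attains, inner_smul_left, inner_self_eq_norm_sq_to_K, ← hA]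
    simp only [RCLike.conj_ofReal, norm_mul, RCLike.norm_ofReal, norm_pow, abs_norm, abs_inv]
    field_simp

/-- When the triangle inequality is an equality, a pair attaining the norm of the sum leaves no
slack for either summand. -/
theorem Attains.of_add {c : 𝕜} (hc : c ≠ 0) (hx : ‖x‖ = 1) (hy : ‖y‖ = 1)
    (hAB : ‖A + c • B‖ = ‖A‖ + ‖c‖ * ‖B‖) (h : Attains x y (A + c • B)) :
    Attains x y A ∧ Attains x y B := by
  have h1 := norm_inner_apply_le hx hy A
  have h2 := norm_inner_apply_le hx hy B
  have h3 : ‖⟪x, (A + c • B) y⟫‖ ≤ ‖⟪x, A y⟫‖ + ‖c‖ * ‖⟪x, B y⟫‖ := by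
    rw [add_apply, inner_add_right, smul_apply,
      inner_smul_right]
    exact (norm_add_le _ _).trans (by rw [norm_mul])
  rw [h, hAB] at h3
  have hc' : 0 < ‖c‖ := norm_pos_iff.2 hc
  have h4 : ‖c‖ * ‖⟪x, B y⟫‖ ≤ ‖c‖ * ‖B‖ := by gcongr
  refine ⟨le_antisymm h1 (by linarith), le_antisymm h2 ?_⟩
  exact le_of_mul_le_mul_left (by linarith) hc'

/-- One phase serves every weight `ε ≥ 0`, so `ε` can be shrunk later without changing `μ`. -/
theorem exists_unit_norm_add (a b : 𝕜) :
    ∃ μ : 𝕜, ‖μ‖ = 1 ∧ ∀ ε : ℝ, 0 ≤ ε → ‖a + (ε * μ) * b‖ = ‖a‖ + ε * ‖b‖ := by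
  by_cases ha : a = 0
  · exact ⟨1, by simp, fun ε hε => by simp [ha, abs_of_nonneg hε]⟩
  by_cases hb : b = 0
  · exact ⟨1, by simp, fun ε hε => by simp [hb]⟩
  have ha' : (‖a‖ : 𝕜) ≠ 0 := by simpa using ha
  have hb' : (‖b‖ : 𝕜) ≠ 0 := by simpa using hb
  refine ⟨(a / ‖a‖) * (‖b‖ / b), ?_, fun ε hε => ?_⟩
  · have h1 := norm_ne_zero_iff.2 ha
    have h2 := norm_ne_zero_iff.2 hb
    simp [h1, h2]
  · have : a + (ε * ((a / ‖a‖) * (‖b‖ / b))) * b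
        = (a / ‖a‖) * ((‖a‖ + ε * ‖b‖ : ℝ) : 𝕜) := by
      push_cast
      field_simp
    rw [this, norm_mul, RCLike.norm_ofReal, abs_of_nonneg (by positivity)]
    have h1 := norm_ne_zero_iff.2 ha
    simp [h1]

theorem Attains.exists_norm_add (hx : ‖x‖ = 1) (hy : ‖y‖ = 1) (hA : Attains x y A)
    (hB : Attains x y B) : ∃ μ : 𝕜, ‖μ‖ = 1 ∧ ∀ ε : ℝ, 0 ≤ ε →
      ‖A + ((ε : 𝕜) * μ) • B‖ = ‖A‖ + ε * ‖B‖ := by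
  obtain ⟨μ, hμ, h⟩ := exists_unit_norm_add ⟪x, A y⟫ ⟪x, B y⟫
  refine ⟨μ, hμ, fun ε hε => le_antisymm ?_ ?_⟩
  · refine (norm_add_le _ _).trans ?_
    rw [norm_smul, norm_mul, hμ, RCLike.norm_ofReal, abs_of_nonneg hε, mul_one]
  · have h1 := norm_inner_apply_le hx hy (A + ((ε : 𝕜) * μ) • B)
    rw [add_apply, inner_add_right, smul_apply,
      inner_smul_right, h ε hε, hA, hB] at h1
    exact h1

theorem Attains.parallel (hx : ‖x‖ = 1) (hy : ‖y‖ = 1) (hA : Attains x y A)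
    (hB : Attains x y B) : Parallel A B := by
  obtain ⟨μ, hμ, h⟩ := hA.exists_norm_add hx hy hB
  exact ⟨μ, hμ, by simpa using h 1 zero_le_one⟩

theorem Parallel.exists_attains [Nontrivial E] [Nontrivial F] (h : Parallel A B) :
    ∃ x : F, ∃ y : E, ‖x‖ = 1 ∧ ‖y‖ = 1 ∧ Attains x y A ∧ Attains x y B := by
  obtain ⟨μ, hμ, h⟩ := h
  obtain ⟨x, y, hx, hy, hC⟩ := ParallelPairs.exists_attains (A + μ • B)
  exact ⟨x, y, hx, hy, hC.of_add (by rintro rfl; simp at hμ) hx hy (by rw [h, hμ, one_mul])⟩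

end Norm

/-! ### Images of faces and thin pairs -/

section Carries

variable {T : (E →L[𝕜] F) →ₗ[𝕜] (E →L[𝕜] F)}

/-- `T` sends the operators whose norm is attained by `(x, y)` to operators whose norm is attained
by `(u, v)`. -/
def Carries (T : (E →L[𝕜] F) →ₗ[𝕜] (E →L[𝕜] F)) (x : F) (y : E) (u : F) (v : E) : Prop :=
  ‖u‖ = 1 ∧ ‖v‖ = 1 ∧ ∀ A, Attains x y A → Attains u v (T A)

/-- Any finite set of operators attaining their norm at `(x, y)` is controlled by a single operator
for which `(x, y)` is a simple top singular pair. -/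
theorem exists_attains_imp_of_finset [Nontrivial E] [Nontrivial F]
    (hT : ∀ A B, Parallel A B → Parallel (T A) (T B))
    {x : F} {y : E} (hx : ‖x‖ = 1) (hy : ‖y‖ = 1) (s : Finset {B : E →L[𝕜] F // Attains x y B}) :
    ∃ β : 𝕜, ∃ X ∈ block x y, ‖X‖ < ‖β‖ ∧ ∀ (u : F) (v : E), ‖u‖ = 1 → ‖v‖ = 1 →
      Attains u v (T (β • rankOne 𝕜 x y + X)) → ∀ B ∈ s, Attains u v (T B) := by
  classical
  induction s using Finset.induction_on with
  | empty => exact ⟨1, 0, zero_mem _, by simp, by simp⟩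
  | insert B s _ ih =>
    obtain ⟨β, X, hX, hlt, h⟩ := ih
    have hA := attains_smul_rankOne_add hx hy hX hlt.le
    obtain ⟨u, v, hu, hv, h1, h2⟩ := (hT _ _ (hA.parallel hx hy B.2)).exists_attains
    -- The phase is chosen for the images and then used to perturb the source: a pair attaining the
    -- norm of the perturbed image must serve both summands.
    obtain ⟨μ, hμ, hadd⟩ := h1.exists_norm_add hu hv h2
    obtain ⟨b, Y, hY, hBY⟩ := exists_aligned_decomp (by rintro rfl; simp at hy)
      (B.2.mem_aligned hx hy)
    -- The perturbation uses up less than half of the gap `‖β‖ - ‖X‖`, which keeps the inequality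
    -- strict.
    set ε : ℝ := (‖β‖ - ‖X‖) / (2 * (1 + ‖Y‖ + ‖b‖)) with hε
    have hεpos : 0 < ε := div_pos (by linarith) (by positivity)
    have hε2 : ε * (1 + ‖Y‖ + ‖b‖) = (‖β‖ - ‖X‖) / 2 := by rw [hε]; field_simp
    have hc : ‖(ε : 𝕜) * μ‖ = ε := by
      rw [norm_mul, hμ, mul_one, RCLike.norm_ofReal, abs_of_pos hεpos]
    have heq : (β + ε * μ * b) • rankOne 𝕜 x y + (X + ((ε : 𝕜) * μ) • Y)
        = (β • rankOne 𝕜 x y + X) + ((ε : 𝕜) * μ) • (B : E →L[𝕜] F) := by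
      rw [hBY]; module
    refine ⟨β + ε * μ * b, X + ((ε : 𝕜) * μ) • Y, add_mem hX (Submodule.smul_mem _ _ hY), ?_, ?_⟩
    · have h3 : ‖X + ((ε : 𝕜) * μ) • Y‖ ≤ ‖X‖ + ε * ‖Y‖ :=
        (norm_add_le _ _).trans (by rw [norm_smul, hc])
      have h4 : ‖β‖ ≤ ‖β + ε * μ * b‖ + ε * ‖b‖ := by
        have := norm_sub_le (β + ε * μ * b) (ε * μ * b)
        rwa [add_sub_cancel_right, norm_mul, hc] at this
      nlinarith
    · intro u' v' hu' hv' hat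
      rw [heq, map_add, map_smul] at hat
      have h5 := hat.of_add (by rw [← norm_pos_iff, hc]; exact hεpos) hu' hv'
        (by rw [hc]; exact hadd ε hεpos.le)
      intro B' hB'
      rcases Finset.mem_insert.1 hB' with rfl | hB'
      · exact h5.2
      · exact h u' v' hu' hv' h5.1 B' hB'

/-- Each image operator is attained on a closed subset of the compact product of unit spheres.
Finitely many of these sets meet by `exists_attains_imp_of_finset`, hence all of them do. -/
theorem exists_carries [Nontrivial E] [Nontrivial F]
    (hT : ∀ A B, Parallel A B → Parallel (T A) (T B))
    {x : F} {y : E} (hx : ‖x‖ = 1) (hy : ‖y‖ = 1) : ∃ u v, Carries T x y u v := by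
  have := FiniteDimensional.proper 𝕜 E
  have := FiniteDimensional.proper 𝕜 F
  have hc : IsCompact (Metric.sphere (0 : F) 1 ×ˢ Metric.sphere (0 : E) 1) :=
    (isCompact_sphere _ _).prod (isCompact_sphere _ _)
  obtain ⟨⟨u, v⟩, ⟨hu, hv⟩, h⟩ := hc.inter_iInter_nonempty
    (fun B : {B : E →L[𝕜] F // Attains x y B} => {p : F × E | Attains p.1 p.2 (T B)})
    (fun B => isClosed_eq (by fun_prop) (by fun_prop)) (fun s => by
      obtain ⟨β, X, hX, hlt, h⟩ := exists_attains_imp_of_finset hT hx hy s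
      obtain ⟨u, v, hu, hv, h1⟩ := exists_attains (T (β • rankOne 𝕜 x y + X))
      exact ⟨(u, v), ⟨by simpa using hu, by simpa using hv⟩,
        Set.mem_iInter₂.2 fun B hB => h u v hu hv h1 B hB⟩)
  exact ⟨u, v, by simpa using hu, by simpa using hv, fun A hA => Set.mem_iInter.1 h ⟨A, hA⟩⟩

theorem Carries.map_mem_aligned {x u : F} {y v : E} (h : Carries T x y u v) (hx : ‖x‖ = 1)
    (hy : ‖y‖ = 1) {A : E →L[𝕜] F} (hA : A ∈ aligned x y) : T A ∈ aligned u v := by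
  obtain ⟨hu, hv, h⟩ := h
  obtain ⟨β, X, hX, rfl⟩ := exists_aligned_decomp (by rintro rfl; simp at hy) hA
  have h1 : ∀ c : 𝕜, ‖X‖ ≤ ‖c‖ → T (c • rankOne 𝕜 x y + X) ∈ aligned u v := fun c hc =>
    (h _ (attains_smul_rankOne_add hx hy hX hc)).mem_aligned hu hv
  have h2 : T (rankOne 𝕜 x y) ∈ aligned u v := by
    have := (h _ (attains_rankOne_add hx hy (zero_mem _) (by simp))).mem_aligned hu hv
    simpa using this
  have h3 := h1 ((‖X‖ : ℝ) : 𝕜) (by simp)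
  rw [map_add, map_smul] at h3 ⊢
  have h4 := sub_mem h3 (Submodule.smul_mem _ ((‖X‖ : ℝ) : 𝕜) h2)
  rw [add_sub_cancel_left] at h4
  exact add_mem (Submodule.smul_mem _ _ h2) h4

/-- The functional `A ↦ ⟪u, T A v⟫`. -/
noncomputable def coeff (T : (E →L[𝕜] F) →ₗ[𝕜] (E →L[𝕜] F)) (u : F) (v : E) :
    (E →L[𝕜] F) →ₗ[𝕜] 𝕜 where
  toFun A := ⟪u, T A v⟫
  map_add' A B := by simp [inner_add_right]
  map_smul' c A := by simp [inner_smul_right]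

theorem coeff_apply (u : F) (v : E) (A : E →L[𝕜] F) : coeff T u v A = ⟪u, T A v⟫ := rfl

theorem Carries.norm_coeff {x u : F} {y v : E} (h : Carries T x y u v) {A : E →L[𝕜] F}
    (hA : Attains x y A) : ‖coeff T u v A‖ = ‖T A‖ := h.2.2 A hA

theorem Carries.norm_coeff_rankOne {x u : F} {y v : E} (h : Carries T x y u v) (hx : ‖x‖ = 1)
    (hy : ‖y‖ = 1) : ‖coeff T u v (rankOne 𝕜 x y)‖ = ‖T (rankOne 𝕜 x y)‖ :=
  h.norm_coeff (by simpa using attains_rankOne_add hx hy (zero_mem (block x y)) (by simp))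

/-- `T` maps `aligned x y` to a subspace of dimension at most one. -/
def Thin (T : (E →L[𝕜] F) →ₗ[𝕜] (E →L[𝕜] F)) (x : F) (y : E) : Prop :=
  ∃ g : (E →L[𝕜] F) →ₗ[𝕜] 𝕜, ∀ A ∈ aligned x y, g A = 0 → T A = 0

theorem Thin.map_mem_span {x : F} {y : E} (h : Thin T x y) {A B : E →L[𝕜] F}
    (hA : A ∈ aligned x y) (hB : B ∈ aligned x y) (h0 : T A ≠ 0) :
    T B ∈ Submodule.span 𝕜 {T A} := by
  obtain ⟨g, hg⟩ := h
  have hgA : g A ≠ 0 := fun h => h0 (hg A hA h)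
  have h1 := hg (B - (g B / g A) • A) (sub_mem hB (Submodule.smul_mem _ _ hA))
    (by simp [hgA])
  rw [map_sub, map_smul, sub_eq_zero] at h1
  exact Submodule.mem_span_singleton.2 ⟨_, h1.symm⟩

/-- Since `‖X‖ < 1`, a small move from the killed operator in any aligned direction stays in the
face, where `‖T ·‖` is the absolute value of `coeff`. A direction killed by `coeff` is thus killed
by `T`. -/
theorem Carries.thin {x u : F} {y v : E} (h : Carries T x y u v) (hx : ‖x‖ = 1) (hy : ‖y‖ = 1)
    {X : E →L[𝕜] F} (hX : X ∈ block x y) (hlt : ‖X‖ < 1) (h0 : T (rankOne 𝕜 x y + X) = 0) :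
    Thin T x y := by
  refine ⟨coeff T u v, fun A hA hgA => ?_⟩
  obtain ⟨β, Y, hY, rfl⟩ := exists_aligned_decomp (by rintro rfl; simp at hy) hA
  set ε : ℝ := (1 - ‖X‖) / (2 * (1 + ‖Y‖ + ‖β‖)) with hε
  have hεpos : 0 < ε := div_pos (by linarith) (by positivity)
  have hε2 : ε * (1 + ‖Y‖ + ‖β‖) = (1 - ‖X‖) / 2 := by rw [hε]; field_simp
  have hc : ‖(ε : 𝕜)‖ = ε := by rw [RCLike.norm_ofReal, abs_of_pos hεpos]
  have h1 : ‖X + (ε : 𝕜) • Y‖ ≤ ‖(1 : 𝕜) + ε * β‖ := by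
    have h3 : ‖X + (ε : 𝕜) • Y‖ ≤ ‖X‖ + ε * ‖Y‖ :=
      (norm_add_le _ _).trans (by rw [norm_smul, hc])
    have h4 : ‖(1 : 𝕜)‖ ≤ ‖1 + ε * β‖ + ε * ‖β‖ := by
      have := norm_sub_le (1 + ε * β) (ε * β)
      rwa [add_sub_cancel_right, norm_mul, hc] at this
    rw [norm_one] at h4
    nlinarith
  have h2 := h.norm_coeff (attains_smul_rankOne_add hx hy
    (add_mem hX (Submodule.smul_mem _ (ε : 𝕜) hY)) h1)
  have h3 : ((1 : 𝕜) + ε * β) • rankOne 𝕜 x y + (X + (ε : 𝕜) • Y)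
    = (rankOne 𝕜 x y + X) + (ε : 𝕜) • (β • rankOne 𝕜 x y + Y) := by module
  rw [h3, map_add _ (rankOne 𝕜 x y + X), map_add _ (rankOne 𝕜 x y + X), h0, map_smul, map_smul,
    hgA, coeff_apply, h0] at h2
  simp only [zero_apply, inner_zero_right, smul_zero, add_zero, norm_zero, zero_add] at h2
  rw [eq_comm, norm_eq_zero, smul_eq_zero] at h2
  exact h2.resolve_left (by simpa using hεpos.ne')

/-- Otherwise some `t • X` of norm less than one cancels the functional against `rankOne 𝕜 x y`, and
`Carries.thin` applies. -/
theorem Carries.norm_coeff_le {x u : F} {y v : E} (h : Carries T x y u v) (hx : ‖x‖ = 1)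
    (hy : ‖y‖ = 1) (hthin : ¬ Thin T x y) {X : E →L[𝕜] F} (hX : X ∈ block x y) :
    ‖coeff T u v X‖ ≤ ‖X‖ * ‖T (rankOne 𝕜 x y)‖ := by
  by_contra! hlt
  set g := coeff T u v
  have hgX : g X ≠ 0 := by
    rw [← norm_pos_iff]; exact lt_of_le_of_lt (by positivity) hlt
  set t : 𝕜 := - g (rankOne 𝕜 x y) / g X with ht
  have hnt : ‖t • X‖ < 1 := by
    rw [norm_smul, ht, norm_div, norm_neg, h.norm_coeff_rankOne hx hy, div_mul_eq_mul_div,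
      div_lt_one (norm_pos_iff.2 hgX), mul_comm]
    exact hlt
  have htX := Submodule.smul_mem (block x y) t hX
  refine hthin (h.thin hx hy htX hnt ?_)
  have h1 := h.norm_coeff (attains_rankOne_add hx hy htX hnt.le)
  rw [← norm_eq_zero, ← h1, map_add, map_smul, ht, smul_eq_mul]
  change ‖g _ + _‖ = 0
  rw [div_mul_cancel₀ _ hgX]
  simp

theorem thin_smul {x : F} {y : E} {a b : 𝕜} (ha : a ≠ 0) (hb : b ≠ 0) :
    Thin T (a • x) (b • y) ↔ Thin T x y := by
  unfold Thin
  rw [aligned_smul ha hb]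

/-- For `‖X‖ = 1`, the bound on `coeff` controls `T (rankOne 𝕜 x y + X)`, and subtracting `T
(rankOne 𝕜 x y)` leaves `T X`. Only the independence of the constant from the pair is used. -/
theorem norm_map_block_le_of_norm_eq_one [Nontrivial E] [Nontrivial F]
    (hT : ∀ A B, Parallel A B → Parallel (T A) (T B))
    {x : F} {y : E} (hx : ‖x‖ = 1) (hy : ‖y‖ = 1) (hthin : ¬ Thin T x y)
    {X : E →L[𝕜] F} (hX : X ∈ block x y) :
    ‖T X‖ ≤ 3 * ‖X‖ * ‖T (rankOne 𝕜 x y)‖ := by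
  obtain ⟨u, v, h⟩ := exists_carries hT hx hy
  by_cases hX0 : X = 0
  · simp [hX0]
  have hn : ‖X‖ ≠ 0 := norm_ne_zero_iff.2 hX0
  set Y : E →L[𝕜] F := ((‖X‖⁻¹ : ℝ) : 𝕜) • X with hYdef
  have hY : Y ∈ block x y := Submodule.smul_mem _ _ hX
  have hY1 : ‖Y‖ = 1 := by simp [hYdef, norm_smul, hn]
  have hXY : X = (‖X‖ : 𝕜) • Y := by
    rw [hYdef, smul_smul, ← RCLike.ofReal_mul, mul_inv_cancel₀ hn]; simp
  have h1 := h.norm_coeff (attains_rankOne_add hx hy hY hY1.le)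
  have h2 := h.norm_coeff_le hx hy hthin hY
  have h3 := norm_add_le (coeff T u v (rankOne 𝕜 x y)) (coeff T u v Y)
  rw [← map_add, h1, h.norm_coeff_rankOne hx hy] at h3
  have h4 : ‖T Y‖ ≤ ‖T (rankOne 𝕜 x y + Y)‖ + ‖T (rankOne 𝕜 x y)‖ := by
    have := norm_sub_le (T (rankOne 𝕜 x y + Y)) (T (rankOne 𝕜 x y))
    rwa [map_add, add_sub_cancel_left, ← map_add] at this
  have h5 : ‖T X‖ = ‖X‖ * ‖T Y‖ := by
    conv_lhs => rw [hXY, map_smul, norm_smul, RCLike.norm_ofReal, abs_norm]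
  rw [hY1] at h2
  rw [h5, mul_comm 3, mul_assoc]
  gcongr
  linarith

theorem norm_map_block_le [Nontrivial E] [Nontrivial F]
    (hT : ∀ A B, Parallel A B → Parallel (T A) (T B))
    {x : F} {y : E} (hx : x ≠ 0) (hy : y ≠ 0) (hthin : ¬ Thin T x y)
    {X : E →L[𝕜] F} (hX : X ∈ block x y) :
    ‖x‖ * ‖y‖ * ‖T X‖ ≤ 3 * ‖X‖ * ‖T (rankOne 𝕜 x y)‖ := by
  have hnx : ‖x‖ ≠ 0 := norm_ne_zero_iff.2 hx
  have hny : ‖y‖ ≠ 0 := norm_ne_zero_iff.2 hy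
  have ha : ((‖x‖⁻¹ : ℝ) : 𝕜) ≠ 0 := by simpa using hx
  have hb : ((‖y‖⁻¹ : ℝ) : 𝕜) ≠ 0 := by simpa using hy
  have h := norm_map_block_le_of_norm_eq_one hT (x := ((‖x‖⁻¹ : ℝ) : 𝕜) • x)
    (y := ((‖y‖⁻¹ : ℝ) : 𝕜) • y) (by simp [norm_smul, hnx]) (by simp [norm_smul, hny])
    (by rwa [thin_smul ha hb]) (X := X) (by rwa [block_smul ha hb])
  simp only [map_smul, map_smulₛₗ, smul_apply, norm_smul,
    RCLike.conj_ofReal, RCLike.norm_ofReal, abs_inv, abs_norm] at h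
  calc ‖x‖ * ‖y‖ * ‖T X‖ ≤ ‖x‖ * ‖y‖ * (3 * ‖X‖ * (‖y‖⁻¹ * (‖x‖⁻¹ * ‖T (rankOne 𝕜 x y)‖))) := by
        gcongr
    _ = _ := by field_simp

/-- A rank one element in the kernel of `T` at which the block is not annihilated is surrounded by
thin pairs. -/
theorem eventually_thin [Nontrivial E] [Nontrivial F]
    (hT : ∀ A B, Parallel A B → Parallel (T A) (T B))
    {x z : F} {y w : E} (hx : x ≠ 0) (hy : y ≠ 0) (h0 : T (rankOne 𝕜 x y) = 0)
    (hz : ⟪x, z⟫ = 0) (hw : ⟪y, w⟫ = 0) (h1 : T (rankOne 𝕜 z w) ≠ 0) :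
    ∀ᶠ p : F × E in 𝓝 (x, y), Thin T p.1 p.2 := by
  -- Projecting `z` and `w` off the moving pair keeps the test operator in the moving block.
  let zf : F → F := fun a => z - (⟪a, z⟫ / ⟪a, a⟫) • a
  let wf : E → E := fun b => w - (⟪b, w⟫ / ⟪b, b⟫) • b
  have hzf : zf x = z := by simp [zf, hz]
  have hwf : wf y = w := by simp [wf, hw]
  have hTc : Continuous T := T.continuous_of_finiteDimensional
  have hxx : ⟪x, x⟫ ≠ 0 := inner_self_ne_zero.2 hx
  have hyy : ⟪y, y⟫ ≠ 0 := inner_self_ne_zero.2 hy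
  have cz : ContinuousAt (fun p : F × E => zf p.1) (x, y) := by
    refine continuousAt_const.sub (ContinuousAt.smul (ContinuousAt.div ?_ ?_ hxx) ?_) <;>
      fun_prop
  have cw : ContinuousAt (fun p : F × E => wf p.2) (x, y) := by
    refine continuousAt_const.sub (ContinuousAt.smul (ContinuousAt.div ?_ ?_ hyy) ?_) <;>
      fun_prop
  have cR : Continuous fun p : F × E => rankOne 𝕜 p.1 p.2 := by
    have h1 : Continuous fun p : F × E => innerSL 𝕜 p.2 :=
      (innerSL 𝕜).continuous.comp continuous_snd
    exact ((ContinuousLinearMap.smulRightL 𝕜 E F).continuous.comp h1).clm_apply continuous_fst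
  have cX : ContinuousAt (fun p : F × E => rankOne 𝕜 (zf p.1) (wf p.2)) (x, y) :=
    ContinuousAt.comp (f := fun p : F × E => (zf p.1, wf p.2)) cR.continuousAt (cz.prodMk cw)
  have c1 : ContinuousAt (fun p : F × E => 3 * ‖rankOne 𝕜 (zf p.1) (wf p.2)‖
      * ‖T (rankOne 𝕜 p.1 p.2)‖) (x, y) :=
    (continuousAt_const.mul cX.norm).mul (hTc.comp cR).continuousAt.norm
  have c2 : ContinuousAt (fun p : F × E => ‖p.1‖ * ‖p.2‖ * ‖T (rankOne 𝕜 (zf p.1) (wf p.2))‖)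
      (x, y) :=
    ContinuousAt.mul (by fun_prop) (ContinuousAt.comp (g := T) hTc.continuousAt cX).norm
  -- The estimate valid at non-thin pairs fails strictly at the centre, hence at all nearby pairs by
  -- continuity.
  have hlt : 3 * ‖rankOne 𝕜 (zf x) (wf y)‖ * ‖T (rankOne 𝕜 x y)‖
      < ‖x‖ * ‖y‖ * ‖T (rankOne 𝕜 (zf x) (wf y))‖ := by
    rw [h0, hzf, hwf, norm_zero, mul_zero]
    have := norm_pos_iff.2 hx
    have := norm_pos_iff.2 hy
    have := norm_pos_iff.2 h1
    positivity
  have e1 : ∀ᶠ p : F × E in 𝓝 (x, y), p.1 ≠ 0 :=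
    continuous_fst.continuousAt.eventually_ne hx
  have e2 : ∀ᶠ p : F × E in 𝓝 (x, y), p.2 ≠ 0 :=
    continuous_snd.continuousAt.eventually_ne hy
  filter_upwards [c1.eventually_lt c2 hlt, e1, e2] with p hp h2 h3
  by_contra hth
  refine absurd (norm_map_block_le hT h2 h3 hth (rankOne_mem_block ?_ ?_)) (not_le.2 hp)
  · simp only [zf, inner_sub_right, inner_smul_right]
    rw [div_mul_cancel₀ _ (inner_self_ne_zero.2 h2), sub_self]
  · simp only [wf, inner_sub_right, inner_smul_right]
    rw [div_mul_cancel₀ _ (inner_self_ne_zero.2 h3), sub_self]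

end Carries

/-! ### Absence of thin pairs -/

section Thin

theorem exists_ne_zero_of_lt_finrank (f g : E →ₗ[𝕜] 𝕜) (hE : 3 ≤ Module.finrank 𝕜 E) :
    ∃ y ≠ 0, f y = 0 ∧ g y = 0 := by
  have h : (f.prod g).ker ≠ ⊥ := LinearMap.ker_ne_bot_of_finrank_lt (by
    rw [Module.finrank_prod, Module.finrank_self]; omega)
  obtain ⟨y, hy, hy0⟩ := Submodule.exists_mem_ne_zero_of_ne_bot h
  exact ⟨y, hy0, by simpa using hy⟩

theorem exists_orthogonal_pair (hE : 3 ≤ Module.finrank 𝕜 E) (y w : E) :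
    ∃ z ≠ 0, ⟪y, z⟫ = 0 ∧ ⟪w, z⟫ = 0 :=
  exists_ne_zero_of_lt_finrank (innerSL 𝕜 y).toLinearMap (innerSL 𝕜 w).toLinearMap hE

theorem exists_orthogonal (hF : 2 ≤ Module.finrank 𝕜 F) (x : F) : ∃ z ≠ 0, ⟪x, z⟫ = 0 := by
  have h : (innerSL 𝕜 x).toLinearMap.ker ≠ ⊥ := LinearMap.ker_ne_bot_of_finrank_lt (by
    rw [Module.finrank_self]; omega)
  obtain ⟨y, hy, hy0⟩ := Submodule.exists_mem_ne_zero_of_ne_bot h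
  exact ⟨y, hy0, by simpa using hy⟩

/-- A functional on operators vanishes at some rank one operator with prescribed range whose
support is orthogonal to a given vector. -/
theorem exists_rankOne_mem_ker (hE : 3 ≤ Module.finrank 𝕜 E) (g : (E →L[𝕜] F) →ₗ[𝕜] 𝕜) (x : F)
    (y : E) : ∃ w ≠ 0, ⟪y, w⟫ = 0 ∧ g (rankOne 𝕜 x w) = 0 := by
  let f : E →ₗ[𝕜] 𝕜 :=
    { toFun := fun w => (starRingEnd 𝕜) (g (rankOne 𝕜 x w))
      map_add' := by simp
      map_smul' := by simp }
  obtain ⟨w, hw0, h1, h2⟩ := exists_ne_zero_of_lt_finrank (innerSL 𝕜 y).toLinearMap f hE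
  exact ⟨w, hw0, h1, by simpa [f] using h2⟩

theorem mem_of_forall_rankOne_mem {P : Submodule 𝕜 (E →L[𝕜] F)}
    (h : ∀ x y, rankOne 𝕜 x y ∈ P) (A : E →L[𝕜] F) : A ∈ P := by
  have h1 := congrArg (A ∘L ·) ((stdOrthonormalBasis 𝕜 E).sum_rankOne_eq_id)
  simp only [ContinuousLinearMap.comp_finsetSum, comp_rankOne, ContinuousLinearMap.comp_id] at h1
  rw [← h1]
  exact sum_mem fun i _ => h _ _

theorem eventually_perturb {P : F × E → Prop} {x : F} {y : E} (h : ∀ᶠ p in 𝓝 (x, y), P p)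
    (a : F) (b : E) : ∀ᶠ ε : ℝ in 𝓝 0, P (x + (ε : 𝕜) • a, y + (ε : 𝕜) • b) := by
  have hc : Continuous fun ε : ℝ => (x + (ε : 𝕜) • a, y + (ε : 𝕜) • b) := by fun_prop
  have := hc.tendsto 0
  simp only [RCLike.ofReal_zero, zero_smul, add_zero] at this
  exact this.eventually h

theorem exists_pos_of_eventually {P : ℝ → Prop} (h : ∀ᶠ ε in 𝓝 0, P ε) : ∃ ε, 0 < ε ∧ P ε := by
  have h1 : ∀ᶠ ε in 𝓝[>] (0 : ℝ), P ε := h.filter_mono nhdsWithin_le_nhds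
  obtain ⟨ε, h2, h3⟩ := (h1.and self_mem_nhdsWithin).exists
  exact ⟨ε, h3, h2⟩

theorem exists_decomp {x : F} (hx : x ≠ 0) (z : F) : ∃ c : 𝕜, ∃ w, ⟪x, w⟫ = 0 ∧ z = c • x + w :=
  ⟨⟪x, z⟫ / ⟪x, x⟫, z - (⟪x, z⟫ / ⟪x, x⟫) • x, by
    rw [inner_sub_right, inner_smul_right, div_mul_cancel₀ _ (inner_self_ne_zero.2 hx), sub_self],
    by simp⟩

variable {T : (E →L[𝕜] F) →ₗ[𝕜] (E →L[𝕜] F)}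

/-- A thin pair whose aligned space contains `rankOne 𝕜 x₁ y₁` has that whole space sent to the same
line. Rank one kernel elements, available since `dim E ≥ 3`, create open sets of thin pairs through
`eventually_thin`; these cover the operators `rankOne 𝕜 x₁ w`, then `rankOne 𝕜 z y₁`, the block of
`(x₁, y₁)` being covered at once. -/
theorem Thin.map_mem_span_of_ne_zero (hE : 3 ≤ Module.finrank 𝕜 E)
    (hF : 2 ≤ Module.finrank 𝕜 F) (hT : ∀ A B, Parallel A B → Parallel (T A) (T B))
    {x₁ : F} {y₁ : E} (hthin : Thin T x₁ y₁) (h1 : T (rankOne 𝕜 x₁ y₁) ≠ 0) (A : E →L[𝕜] F) :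
    T A ∈ Submodule.span 𝕜 {T (rankOne 𝕜 x₁ y₁)} := by
  have : Nontrivial E := Module.nontrivial_of_finrank_pos (R := 𝕜) (by omega)
  have : Nontrivial F := Module.nontrivial_of_finrank_pos (R := 𝕜) (by omega)
  have hx₁ : x₁ ≠ 0 := by rintro rfl; simp at h1
  have hy₁ : y₁ ≠ 0 := by rintro rfl; simp at h1
  set P := (Submodule.span 𝕜 {T (rankOne 𝕜 x₁ y₁)}).comap T with hP
  have hmem : ∀ {x y}, Thin T x y → rankOne 𝕜 x₁ y₁ ∈ aligned x y →
      ∀ B ∈ aligned x y, B ∈ P := fun ht hR B hB => ht.map_mem_span hR hB h1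
  have hblock : ∀ z w, ⟪x₁, z⟫ = 0 → ⟪y₁, w⟫ = 0 → rankOne 𝕜 z w ∈ P := fun z w hz hw =>
    hmem hthin (rankOne_mem_aligned _ _) _ (block_le_aligned _ _ (rankOne_mem_block hz hw))
  have hrow : ∀ w, rankOne 𝕜 x₁ w ∈ P := by
    obtain ⟨x₂, hx₂, h12⟩ := exists_orthogonal hF x₁
    have h21 := inner_eq_zero_symm.1 h12
    obtain ⟨g, hg⟩ := id hthin
    obtain ⟨y₀, hy₀, h10, hg0⟩ := exists_rankOne_mem_ker hE g x₂ y₁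
    have h01 := inner_eq_zero_symm.1 h10
    have h0 := hg _ (block_le_aligned _ _ (rankOne_mem_block h12 h10)) hg0
    have hev := eventually_thin hT hx₂ hy₀ h0 h21 h01 h1
    obtain ⟨y₃, hy₃, h03, h13⟩ := exists_orthogonal_pair hE y₀ y₁
    obtain ⟨ε, hε, ht⟩ := exists_pos_of_eventually (eventually_perturb (𝕜 := 𝕜) hev 0 y₃)
    simp only [smul_zero, add_zero] at ht
    have hε0 : (ε : 𝕜) ≠ 0 := by simpa using hε.ne'
    have key : ∀ {y}, Thin T x₂ y → ⟪y, y₁⟫ = 0 → ∀ w, ⟪y, w⟫ = 0 → rankOne 𝕜 x₁ w ∈ P :=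
      fun ht hy w hw => hmem ht (block_le_aligned _ _ (rankOne_mem_block h21 hy)) _
        (block_le_aligned _ _ (rankOne_mem_block h21 hw))
    have k0 := key hev.self_of_nhds h01
    have k1 := key ht (by
      rw [inner_add_left, inner_smul_left, h01, inner_eq_zero_symm.1 h13, mul_zero, add_zero])
    -- The thin pairs at `y₀` and `y₀ + ε y₃` give two distinct hyperplanes of admissible `w`;
    -- together they span `E`.
    have hy₀P : rankOne 𝕜 x₁ y₀ ∈ P := by
      have h33 : ⟪y₃, y₃⟫ ≠ 0 := inner_self_ne_zero.2 hy₃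
      have h := k1 (y₀ - (⟪y₀, y₀⟫ / (ε * ⟪y₃, y₃⟫)) • y₃) (by
        simp only [inner_sub_right, inner_add_left, inner_smul_left, inner_smul_right, h03,
          inner_eq_zero_symm.1 h03, RCLike.conj_ofReal]
        field_simp
        ring)
      rw [map_sub, map_smulₛₗ] at h
      exact (Submodule.sub_mem_iff_left _ (Submodule.smul_mem P _ (k0 y₃ h03))).1 h
    intro w
    obtain ⟨c, w', hw', rfl⟩ := exists_decomp (𝕜 := 𝕜) hy₀ w
    rw [map_add, map_smulₛₗ]
    exact add_mem (Submodule.smul_mem _ _ hy₀P) (k0 _ hw')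
  have hcol : ∀ z, ⟪x₁, z⟫ = 0 → rankOne 𝕜 z y₁ ∈ P := by
    intro z hz
    obtain ⟨v, hv⟩ : ∃ v, T (rankOne 𝕜 x₁ y₁) v ≠ 0 := by
      by_contra! h
      exact h1 (by ext v; simpa using h v)
    -- The operators `rankOne 𝕜 x₁ w` already map to a line, so one functional nonzero on that line
    -- detects when the image vanishes.
    obtain ⟨y₀, hy₀, h10, hg0⟩ :=
      exists_rankOne_mem_ker hE (coeff T (T (rankOne 𝕜 x₁ y₁) v) v) x₁ y₁
    have h0 : T (rankOne 𝕜 x₁ y₀) = 0 := by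
      obtain ⟨c, hc⟩ := Submodule.mem_span_singleton.1 (hrow y₀)
      rw [coeff_apply, ← hc, smul_apply, inner_smul_right, mul_eq_zero, inner_self_eq_zero] at hg0
      rw [← hc, hg0.resolve_right hv, zero_smul]
    by_cases hz0 : T (rankOne 𝕜 z y₁) = 0
    · rw [hP, Submodule.mem_comap, hz0]; exact zero_mem _
    have h01 := inner_eq_zero_symm.1 h10
    have hev := eventually_thin hT hx₁ hy₀ h0 hz h01 hz0
    obtain ⟨ε, hε, ht⟩ := exists_pos_of_eventually (eventually_perturb (𝕜 := 𝕜) hev 0 y₁)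
    simp only [smul_zero, add_zero] at ht
    have hε0 : (ε : 𝕜) ≠ 0 := by simpa using hε.ne'
    have h00 : ⟪y₀, y₀⟫ ≠ 0 := inner_self_ne_zero.2 hy₀
    have hR : T (rankOne 𝕜 x₁ (y₀ + (ε : 𝕜) • y₁)) = (ε : 𝕜) • T (rankOne 𝕜 x₁ y₁) := by
      rw [map_add, map_add, h0, zero_add, map_smulₛₗ, map_smul, RCLike.conj_ofReal]
    have hmem' := ht.map_mem_span (rankOne_mem_aligned _ _) (B := rankOne 𝕜 z
      (y₁ - (ε * ⟪y₁, y₁⟫ / ⟪y₀, y₀⟫) • y₀)) (block_le_aligned _ _ (rankOne_mem_block hz (by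
        simp only [inner_sub_right, inner_add_left, inner_smul_left, inner_smul_right, h10, h01,
          RCLike.conj_ofReal]
        field_simp
        simp))) (by rw [hR]; exact smul_ne_zero hε0 h1)
    rw [hR, Submodule.span_singleton_smul_eq (IsUnit.mk0 _ hε0)] at hmem'
    have h2 : rankOne 𝕜 z (y₁ - (ε * ⟪y₁, y₁⟫ / ⟪y₀, y₀⟫) • y₀) ∈ P := hmem'
    rw [map_sub, map_smulₛₗ] at h2
    exact (Submodule.sub_mem_iff_left _ (Submodule.smul_mem P _ (hblock z y₀ hz h10))).1 h2
  refine mem_of_forall_rankOne_mem (P := P) (fun x y => ?_) A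
  obtain ⟨a, z, hz, rfl⟩ := exists_decomp (𝕜 := 𝕜) hx₁ x
  obtain ⟨b, w, hw, rfl⟩ := exists_decomp (𝕜 := 𝕜) hy₁ y
  rw [map_add (rankOne 𝕜), add_apply, map_smul (rankOne 𝕜), smul_apply]
  refine add_mem (Submodule.smul_mem _ _ (hrow _)) ?_
  rw [map_add, map_smulₛₗ]
  exact add_mem (Submodule.smul_mem _ _ (hcol z hz)) (hblock z w hz hw)

/-- By the previous result, thin pairs have their rank one operator in the kernel. This makes kernel
membership pass from a pair to every pair orthogonal to it, and a few such moves reach all rank one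
operators. -/
theorem map_rankOne_ne_zero (hE : 3 ≤ Module.finrank 𝕜 E)
    (hF : 2 ≤ Module.finrank 𝕜 F) (hT : ∀ A B, Parallel A B → Parallel (T A) (T B))
    (hrk : ∀ B, ∃ A, T A ∉ Submodule.span 𝕜 {B}) {x : F} {y : E} (hx : x ≠ 0) (hy : y ≠ 0) :
    T (rankOne 𝕜 x y) ≠ 0 := by
  have : Nontrivial E := Module.nontrivial_of_finrank_pos (R := 𝕜) (by omega)
  have : Nontrivial F := Module.nontrivial_of_finrank_pos (R := 𝕜) (by omega)
  have hne : ∃ x y, T (rankOne 𝕜 x y) ≠ 0 := by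
    by_contra! h
    obtain ⟨A, hA⟩ := hrk 0
    refine hA ?_
    rw [show T A = 0 from mem_of_forall_rankOne_mem (P := LinearMap.ker T) h A]
    exact zero_mem _
  have hthin : ∀ {x y}, Thin T x y → T (rankOne 𝕜 x y) = 0 := fun ht => by
    by_contra h
    obtain ⟨A, hA⟩ := hrk _
    exact hA (ht.map_mem_span_of_ne_zero hE hF hT h A)
  have hblock : ∀ {x y}, x ≠ 0 → y ≠ 0 → T (rankOne 𝕜 x y) = 0 → ∀ z w, ⟪x, z⟫ = 0 → ⟪y, w⟫ = 0 →
      T (rankOne 𝕜 z w) = 0 := by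
    intro x y hx hy h0 z w hz hw
    by_contra h
    have hev := eventually_thin hT hx hy h0 hz hw h
    obtain ⟨a, b, hab⟩ := hne
    have e1 := eventually_perturb (𝕜 := 𝕜) hev a b
    have e2 := eventually_perturb (𝕜 := 𝕜) hev (-a) (-b)
    obtain ⟨ε, hε, t1, t2⟩ := exists_pos_of_eventually (e1.and e2)
    have hε0 : (ε : 𝕜) ≠ 0 := by simpa using hε.ne'
    -- A second difference about `(x, y)`: the first-order terms cancel and the value at the centre
    -- is zero, leaving `2 ε² T (rankOne 𝕜 a b)`.
    have h3 := congrArg₂ (· + ·) (hthin t1) (hthin t2)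
    simp only [map_add, add_apply, map_smul, smul_apply, map_smulₛₗ, map_neg, neg_apply, h0,
      RCLike.conj_ofReal, add_zero, zero_add] at h3
    have h4 : (2 * ε * ε : 𝕜) • T (rankOne 𝕜 a b) = 0 := by
      rw [← h3]; module
    exact hab ((smul_eq_zero.1 h4).resolve_left (by simp [hε0]))
  intro h0
  have hrow : ∀ w, T (rankOne 𝕜 x w) = 0 := by
    intro w
    obtain ⟨z, hz0, hz⟩ := exists_orthogonal hF x
    obtain ⟨y', hy0, hyy, hyw⟩ := exists_orthogonal_pair hE y w
    exact hblock hz0 hy0 (hblock hx hy h0 z y' hz hyy) x w (inner_eq_zero_symm.1 hz)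
      (inner_eq_zero_symm.1 hyw)
  obtain ⟨a, b, hab⟩ := hne
  obtain ⟨c, z, hz, rfl⟩ := exists_decomp (𝕜 := 𝕜) hx a
  obtain ⟨w, hw0, hw, -⟩ := exists_orthogonal_pair hE b b
  refine hab ?_
  rw [map_add (rankOne 𝕜), add_apply, map_smul (rankOne 𝕜), smul_apply, map_add, map_smul, hrow,
    hblock hx hw0 (hrow w) z b hz (inner_eq_zero_symm.1 hw), smul_zero, add_zero]

theorem not_thin (hE : 3 ≤ Module.finrank 𝕜 E)
    (hF : 2 ≤ Module.finrank 𝕜 F) (hT : ∀ A B, Parallel A B → Parallel (T A) (T B))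
    (hrk : ∀ B, ∃ A, T A ∉ Submodule.span 𝕜 {B}) {x : F} {y : E} (hx : x ≠ 0) (hy : y ≠ 0) :
    ¬ Thin T x y := fun ht => by
  obtain ⟨A, hA⟩ := hrk _
  exact hA (ht.map_mem_span_of_ne_zero hE hF hT (map_rankOne_ne_zero hE hF hT hrk hx hy) A)

end Thin

/-! ### Splitting off singular pairs -/

section Peel

/-- One step of the singular value decomposition; the phase is absorbed into `x` so that the
coefficient is `‖A‖`. -/
theorem exists_top_decomp [Nontrivial E] [Nontrivial F] (A : E →L[𝕜] F) :
    ∃ x : F, ∃ y : E, ‖x‖ = 1 ∧ ‖y‖ = 1 ∧ ∃ X ∈ block x y,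
      A = ((‖A‖ : ℝ) : 𝕜) • rankOne 𝕜 x y + X ∧ ‖X‖ ≤ ‖A‖ := by
  obtain ⟨x, y, hx, hy, h⟩ := exists_attains A
  by_cases hA : A = 0
  · exact ⟨x, y, hx, hy, 0, zero_mem _, by simp [hA], by simp⟩
  obtain ⟨β, X, hX, hAX⟩ := exists_aligned_decomp (by rintro rfl; simp at hy)
    (h.mem_aligned hx hy)
  have hβ : ‖A‖ = ‖β‖ := by
    rw [← h, hAX, inner_smul_rankOne_add_apply hx hy β hX]
  have hn : ‖A‖ ≠ 0 := norm_ne_zero_iff.2 hA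
  have hn' : ((‖A‖ : ℝ) : 𝕜) ≠ 0 := by simpa using hA
  have hβ0 : β ≠ 0 := by rw [← norm_ne_zero_iff, ← hβ]; exact hn
  refine ⟨(β / ((‖A‖ : ℝ) : 𝕜)) • x, y, ?_, hy, X, ?_, ?_, ?_⟩
  · rw [norm_smul, norm_div, hx, RCLike.norm_ofReal, abs_norm, ← hβ, div_self hn, mul_one]
  · have := block_smul (x := x) (y := y) (div_ne_zero hβ0 hn') one_ne_zero
    rw [one_smul] at this
    rwa [this]
  · rw [map_smul (rankOne 𝕜), smul_apply, smul_smul, mul_div_cancel₀ _ hn']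
    exact hAX
  · rw [hβ]
    rw [hAX] at h
    exact h.norm_block_le hx hy hX

theorem orthogonal_of_mem_block {x x₁ : F} {y y₁ : E} (hx : ‖x‖ = 1) (hy : ‖y‖ = 1) {c : 𝕜}
    (hc : c ≠ 0) {X : E →L[𝕜] F} (hX : X ∈ block x y)
    (hA : c • rankOne 𝕜 x y + X ∈ block x₁ y₁) :
    ⟪x₁, x⟫ = 0 ∧ ⟪y₁, y⟫ = 0 ∧ X ∈ block x₁ y₁ := by
  have h1 : ⟪x₁, x⟫ = 0 := by
    have := hA.2 y
    simpa [hX.1, inner_self_eq_norm_sq_to_K, hy, inner_smul_right, hc] using this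
  have h2 : ⟪y₁, y⟫ = 0 := by
    have := congrArg (fun w => ⟪x, w⟫) hA.1
    simp only [add_apply, smul_apply, rankOne_apply, inner_add_right, inner_smul_right, hX.2,
      inner_self_eq_norm_sq_to_K, hx, inner_zero_right] at this
    simp only [RCLike.ofReal_one, one_pow, mul_one, add_zero, mul_eq_zero, hc, false_or] at this
    exact inner_eq_zero_symm.1 this
  exact ⟨h1, h2, ((block x₁ y₁).add_mem_iff_right
    (Submodule.smul_mem _ _ (rankOne_mem_block h1 h2))).1 hA⟩

/-- The larger range also contains `x`, which is orthogonal to the range of `X`. -/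
theorem finrank_range_lt {x : F} {y : E} (hx : x ≠ 0) (hy : y ≠ 0) {c : 𝕜} (hc : c ≠ 0)
    {X : E →L[𝕜] F} (hX : X ∈ block x y) :
    Module.finrank 𝕜 X.toLinearMap.range
      < Module.finrank 𝕜 (c • rankOne 𝕜 x y + X).toLinearMap.range := by
  have hyy : ⟪y, y⟫ ≠ 0 := inner_self_ne_zero.2 hy
  refine Submodule.finrank_lt_finrank_of_lt (lt_of_le_of_ne ?_ ?_)
  · rintro _ ⟨z, rfl⟩
    obtain ⟨b, w, hw, rfl⟩ := exists_decomp (𝕜 := 𝕜) hy z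
    exact ⟨w, by simp [hX.1, hw]⟩
  · intro heq
    have hmem : x ∈ (c • rankOne 𝕜 x y + X).toLinearMap.range :=
      ⟨(c * ⟪y, y⟫)⁻¹ • y, by
        rw [map_smul]
        simp only [ContinuousLinearMap.coe_coe, add_apply, smul_apply, rankOne_apply, hX.1,
          add_zero, smul_smul]
        rw [inv_mul_cancel₀ (mul_ne_zero hc hyy), one_smul]⟩
    rw [← heq] at hmem
    obtain ⟨z, hz⟩ := hmem
    have h1 := hX.2 z
    rw [show X z = x from hz, inner_self_eq_zero] at h1
    exact hx h1

end Peel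

/-! ### Injectivity -/

section Injective

variable {T : (E →L[𝕜] F) →ₗ[𝕜] (E →L[𝕜] F)}

/-- On the operators whose norm is attained at `(x, y)`, the seminorm `‖T ·‖` is the absolute value
of a multiple of the functional equal to `1` at `rankOne 𝕜 x y` and to `h` on the block. -/
def IsFaceForm (T : (E →L[𝕜] F) →ₗ[𝕜] (E →L[𝕜] F)) (x : F) (y : E)
    (h : (E →L[𝕜] F) →ₗ[𝕜] 𝕜) : Prop :=
  (∀ X ∈ block x y, ‖h X‖ ≤ ‖X‖) ∧ ∀ c : 𝕜, ∀ X ∈ block x y, ‖X‖ ≤ ‖c‖ →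
    ‖T (c • rankOne 𝕜 x y + X)‖ = ‖T (rankOne 𝕜 x y)‖ * ‖c + h X‖

theorem exists_isFaceForm (hE : 3 ≤ Module.finrank 𝕜 E)
    (hF : 2 ≤ Module.finrank 𝕜 F) (hT : ∀ A B, Parallel A B → Parallel (T A) (T B))
    (hrk : ∀ B, ∃ A, T A ∉ Submodule.span 𝕜 {B}) {x : F} {y : E} (hx : ‖x‖ = 1) (hy : ‖y‖ = 1) :
    ∃ h, IsFaceForm T x y h := by
  have : Nontrivial E := Module.nontrivial_of_finrank_pos (R := 𝕜) (by omega)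
  have : Nontrivial F := Module.nontrivial_of_finrank_pos (R := 𝕜) (by omega)
  have hx0 : x ≠ 0 := by rintro rfl; simp at hx
  have hy0 : y ≠ 0 := by rintro rfl; simp at hy
  obtain ⟨u, v, hc⟩ := exists_carries hT hx hy
  have hR := map_rankOne_ne_zero hE hF hT hrk hx0 hy0
  have hR' : 0 < ‖T (rankOne 𝕜 x y)‖ := norm_pos_iff.2 hR
  have hg := hc.norm_coeff_rankOne hx hy
  have hg0 : coeff T u v (rankOne 𝕜 x y) ≠ 0 := by rw [← norm_pos_iff, hg]; exact hR'
  refine ⟨(coeff T u v (rankOne 𝕜 x y))⁻¹ • coeff T u v, fun X hX => ?_, fun c X hX hcX => ?_⟩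
  · rw [LinearMap.smul_apply, norm_smul, norm_inv, hg, inv_mul_le_iff₀ hR', mul_comm]
    exact hc.norm_coeff_le hx hy (not_thin hE hF hT hrk hx0 hy0) hX
  · rw [← hc.norm_coeff (attains_smul_rankOne_add hx hy hX hcX), ← hg, ← norm_mul, mul_add,
      LinearMap.smul_apply, smul_eq_mul, mul_inv_cancel_left₀ hg0, map_add, map_smul, smul_eq_mul,
      mul_comm c]

variable {x₁ x₂ x₃ : F} {y₁ y₂ y₃ : E} {h₁ h₂ h₃ : (E →L[𝕜] F) →ₗ[𝕜] 𝕜}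

theorem IsFaceForm.norm_map_add (h : IsFaceForm T x₁ y₁ h₁) {X : E →L[𝕜] F}
    (hX : X ∈ block x₁ y₁) (hX1 : ‖X‖ ≤ 1) :
    ‖T (rankOne 𝕜 x₁ y₁ + X)‖ = ‖T (rankOne 𝕜 x₁ y₁)‖ * ‖1 + h₁ X‖ := by
  simpa using h.2 1 X hX (by simpa using hX1)

theorem IsFaceForm.eq_neg_one (h : IsFaceForm T x₁ y₁ h₁) (hR : T (rankOne 𝕜 x₁ y₁) ≠ 0)
    {X : E →L[𝕜] F} (hX : X ∈ block x₁ y₁) (hX1 : ‖X‖ ≤ 1) :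
    T (rankOne 𝕜 x₁ y₁ + X) = 0 ↔ h₁ X = -1 := by
  rw [← norm_eq_zero, h.norm_map_add hX hX1, mul_eq_zero, norm_eq_zero, norm_eq_zero,
    or_iff_right hR, add_comm, add_eq_zero_iff_eq_neg]

theorem norm_rankOne_add_le (hx : ‖x₁‖ = 1) (hy : ‖y₁‖ = 1) {X : E →L[𝕜] F}
    (hX : X ∈ block x₁ y₁) (hX1 : ‖X‖ ≤ 1) : ‖rankOne 𝕜 x₁ y₁ + X‖ ≤ 1 := by
  simpa using norm_smul_rankOne_add_le (β := (1 : 𝕜)) hx hy hX (by simpa using hX1)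

/-- If the sum were killed, the face functional would be `-1` at `rankOne 𝕜 x₂ y₂`. Rotating `y₂`
towards a third direction `y₃` would then change the functional to second order only, but the image
under `T` to first order. -/
theorem map_rankOne_add_rankOne_ne_zero (hE : 3 ≤ Module.finrank 𝕜 E)
    (hF : 2 ≤ Module.finrank 𝕜 F) (hT : ∀ A B, Parallel A B → Parallel (T A) (T B))
    (hrk : ∀ B, ∃ A, T A ∉ Submodule.span 𝕜 {B})
    (hx₁ : ‖x₁‖ = 1) (hy₁ : ‖y₁‖ = 1) (hx₂ : ‖x₂‖ = 1) (hy₂ : ‖y₂‖ = 1)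
    (hx : ⟪x₁, x₂⟫ = 0) (hy : ⟪y₁, y₂⟫ = 0) :
    T (rankOne 𝕜 x₁ y₁ + rankOne 𝕜 x₂ y₂) ≠ 0 := by
  intro h0
  have hne : ∀ {x : F} {y : E}, ‖x‖ = 1 → ‖y‖ = 1 → T (rankOne 𝕜 x y) ≠ 0 := fun hx hy =>
    map_rankOne_ne_zero hE hF hT hrk (by rintro rfl; simp at hx) (by rintro rfl; simp at hy)
  obtain ⟨y₃, hy₃, h13, h23⟩ : ∃ y₃ : E, ‖y₃‖ = 1 ∧ ⟪y₁, y₃⟫ = 0 ∧ ⟪y₂, y₃⟫ = 0 := by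
    obtain ⟨y, hy0, h1, h2⟩ := exists_orthogonal_pair (𝕜 := 𝕜) hE y₁ y₂
    have hn : ‖y‖ ≠ 0 := norm_ne_zero_iff.2 hy0
    exact ⟨((‖y‖⁻¹ : ℝ) : 𝕜) • y, by simp [norm_smul, hn], by simp [inner_smul_right, h1],
      by simp [inner_smul_right, h2]⟩
  obtain ⟨h, hf⟩ := exists_isFaceForm hE hF hT hrk hx₁ hy₁
  have m2 := rankOne_mem_block (𝕜 := 𝕜) hx hy
  have m3 := rankOne_mem_block (𝕜 := 𝕜) hx h13
  have hd : h (rankOne 𝕜 x₂ y₂) = -1 := (hf.eq_neg_one (hne hx₁ hy₁) m2 (by simp [hx₂, hy₂])).1 h0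
  have hnorm : ∀ a b : 𝕜, ‖a • rankOne 𝕜 x₂ y₂ + b • rankOne 𝕜 x₂ y₃‖ ^ 2 = ‖a‖ ^ 2 + ‖b‖ ^ 2 := by
    intro a b
    have : a • rankOne 𝕜 x₂ y₂ + b • rankOne 𝕜 x₂ y₃
        = rankOne 𝕜 x₂ ((starRingEnd 𝕜 a) • y₂ + (starRingEnd 𝕜 b) • y₃) := by
      simp
    rw [this, norm_rankOne, hx₂, one_mul, pow_two,
      norm_add_sq_eq_norm_sq_add_norm_sq_of_inner_eq_zero (𝕜 := 𝕜)]
    · simp [norm_smul, hy₂, hy₃]; ring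
    · simp [inner_smul_left, inner_smul_right, h23]
  set e := h (rankOne 𝕜 x₂ y₃) with he
  -- On the Euclidean plane spanned by the two operators, `h` has norm at most one and attains it at
  -- the first, so it vanishes at the second.
  have he0 : e = 0 := by
    set X := (1 : 𝕜) • rankOne 𝕜 x₂ y₂ + (-(starRingEnd 𝕜 e)) • rankOne 𝕜 x₂ y₃ with hX
    have hXm : X ∈ block x₁ y₁ :=
      add_mem (Submodule.smul_mem _ _ m2) (Submodule.smul_mem _ _ m3)
    have h1 := hf.1 X hXm
    have h2 : h X = -((1 + ‖e‖ ^ 2 : ℝ) : 𝕜) := by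
      rw [hX, map_add, map_smul, map_smul, hd, ← he, smul_eq_mul, smul_eq_mul, neg_mul,
        RCLike.conj_mul]
      push_cast; ring
    have h3 := hnorm 1 (-(starRingEnd 𝕜 e))
    rw [← hX] at h3
    rw [h2, norm_neg, RCLike.norm_ofReal, abs_of_nonneg (by positivity)] at h1
    rw [norm_one, norm_neg, RCLike.norm_conj] at h3
    have h4 : ‖e‖ ^ 2 ≤ 0 := by nlinarith [sq_nonneg ‖e‖, norm_nonneg X]
    have h5 : ‖e‖ = 0 := by nlinarith [norm_nonneg e]
    exact norm_eq_zero.1 h5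
  have hp3 : 0 < ‖T (rankOne 𝕜 x₂ y₃)‖ := norm_pos_iff.2 (hne hx₂ hy₃)
  have hp1 : 0 < ‖T (rankOne 𝕜 x₁ y₁)‖ := norm_pos_iff.2 (hne hx₁ hy₁)
  set p := ‖T (rankOne 𝕜 x₂ y₃)‖
  set a := ‖T (rankOne 𝕜 x₁ y₁)‖
  set ε : ℝ := p / (4 * a) with hε
  have hεpos : 0 < ε := by positivity
  have hεa : 4 * a * ε = p := by rw [hε]; field_simp
  -- The identity `(1 - ε²)² + (2ε)² = (1 + ε²)²` puts `X` within the face with coefficient `1 +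
  -- ε²`.
  set X := ((1 - ε ^ 2 : ℝ) : 𝕜) • rankOne 𝕜 x₂ y₂ + ((2 * ε : ℝ) : 𝕜) • rankOne 𝕜 x₂ y₃ with hX
  have hXm : X ∈ block x₁ y₁ :=
    add_mem (Submodule.smul_mem _ _ m2) (Submodule.smul_mem _ _ m3)
  have hXn : ‖X‖ ≤ ‖((1 + ε ^ 2 : ℝ) : 𝕜)‖ := by
    have h3 := hnorm ((1 - ε ^ 2 : ℝ) : 𝕜) ((2 * ε : ℝ) : 𝕜)
    rw [← hX, RCLike.norm_ofReal, RCLike.norm_ofReal, sq_abs, sq_abs] at h3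
    rw [RCLike.norm_ofReal, abs_of_nonneg (by positivity)]
    exact abs_le_of_sq_le_sq' (by rw [h3]; apply le_of_eq; ring) (by positivity) |>.2
  have h1 := hf.2 _ X hXm hXn
  have h2 : ((1 + ε ^ 2 : ℝ) : 𝕜) + h X = ((2 * ε ^ 2 : ℝ) : 𝕜) := by
    rw [hX, map_add, map_smul, map_smul, hd, ← he, he0]
    push_cast
    simp only [smul_eq_mul, mul_zero]
    ring
  have h3 : T (((1 + ε ^ 2 : ℝ) : 𝕜) • rankOne 𝕜 x₁ y₁ + X)
      = ((2 * ε ^ 2 : ℝ) : 𝕜) • T (rankOne 𝕜 x₁ y₁) + ((2 * ε : ℝ) : 𝕜) • T (rankOne 𝕜 x₂ y₃) := by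
    have h4 : T (rankOne 𝕜 x₂ y₂) = - T (rankOne 𝕜 x₁ y₁) := by
      rw [map_add, add_comm] at h0
      exact eq_neg_of_add_eq_zero_left h0
    rw [hX, map_add, map_add, map_smul, map_smul, map_smul, h4]
    push_cast
    module
  rw [h2, h3, RCLike.norm_ofReal, abs_of_nonneg (by positivity)] at h1
  have h5 := norm_sub_le (((2 * ε ^ 2 : ℝ) : 𝕜) • T (rankOne 𝕜 x₁ y₁)
    + ((2 * ε : ℝ) : 𝕜) • T (rankOne 𝕜 x₂ y₃)) (((2 * ε ^ 2 : ℝ) : 𝕜) • T (rankOne 𝕜 x₁ y₁))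
  rw [add_sub_cancel_left, h1, norm_smul, norm_smul, RCLike.norm_ofReal, RCLike.norm_ofReal,
    abs_of_nonneg (by positivity), abs_of_nonneg (by positivity)] at h5
  have h6 : 2 * ε * p ≤ 2 * ε * (2 * a * ε) := by nlinarith
  have h7 := le_of_mul_le_mul_left h6 (by positivity)
  linarith

theorem eq_neg_ofReal_norm {d e : 𝕜} (h : d + e = -1) (hn : ‖d‖ + ‖e‖ ≤ 1) :
    d = -((‖d‖ : ℝ) : 𝕜) := by
  have h1 := congrArg RCLike.re h
  simp only [map_add, map_neg, RCLike.one_re] at h1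
  have h2 := (abs_le.1 (RCLike.abs_re_le_norm d)).1
  have h3 := (abs_le.1 (RCLike.abs_re_le_norm e)).1
  have h4 : RCLike.re (-d) = ‖-d‖ := by rw [map_neg, norm_neg]; linarith
  have h5 := RCLike.re_eq_self_of_le h4.ge
  rw [h4, norm_neg] at h5
  rw [h5, neg_neg]

theorem IsFaceForm.norm_add_le (h : IsFaceForm T x₁ y₁ h₁) (hx₂ : ‖x₂‖ = 1) (hy₂ : ‖y₂‖ = 1)
    (hx : ⟪x₁, x₂⟫ = 0) (hy : ⟪y₁, y₂⟫ = 0) {B : E →L[𝕜] F} (hB₁ : B ∈ block x₁ y₁)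
    (hB₂ : B ∈ block x₂ y₂) {r : ℝ} (hr : 0 ≤ r) (hB : r * ‖B‖ ≤ 1) :
    ‖h₁ (rankOne 𝕜 x₂ y₂)‖ + r * ‖h₁ B‖ ≤ 1 := by
  obtain ⟨μ, hμ, hadd⟩ := exists_unit_norm_add (h₁ (rankOne 𝕜 x₂ y₂)) (h₁ B)
  rw [← hadd r hr, ← smul_eq_mul, ← map_smul, ← map_add]
  refine (h.1 _ (add_mem (rankOne_mem_block hx hy) (Submodule.smul_mem _ _ hB₁))).trans ?_
  refine norm_rankOne_add_le hx₂ hy₂ (Submodule.smul_mem _ _ hB₂) ?_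
  rwa [norm_smul, norm_mul, hμ, mul_one, RCLike.norm_ofReal, abs_of_nonneg hr]

theorem IsFaceForm.eq_neg_norm (h : IsFaceForm T x₁ y₁ h₁) (hR : T (rankOne 𝕜 x₁ y₁) ≠ 0)
    (hx₂ : ‖x₂‖ = 1) (hy₂ : ‖y₂‖ = 1)
    (hx : ⟪x₁, x₂⟫ = 0) (hy : ⟪y₁, y₂⟫ = 0) {B : E →L[𝕜] F} (hB₁ : B ∈ block x₁ y₁)
    (hB₂ : B ∈ block x₂ y₂) (hB : ‖B‖ ≤ 1)
    (h0 : T (rankOne 𝕜 x₁ y₁ + (rankOne 𝕜 x₂ y₂ + B)) = 0) :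
    h₁ (rankOne 𝕜 x₂ y₂) = -((‖h₁ (rankOne 𝕜 x₂ y₂)‖ : ℝ) : 𝕜) ∧
      ‖h₁ (rankOne 𝕜 x₂ y₂)‖ ≤ 1 := by
  have h1 := h.norm_add_le hx₂ hy₂ hx hy hB₁ hB₂ zero_le_one (by simpa using hB)
  rw [one_mul] at h1
  have h2 := (h.eq_neg_one hR (add_mem (rankOne_mem_block hx hy) hB₁)
    (norm_rankOne_add_le hx₂ hy₂ hB₂ hB)).1 h0
  rw [map_add] at h2
  exact ⟨eq_neg_ofReal_norm h2 h1, by linarith [norm_nonneg (h₁ B)]⟩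

/-- Computing the norms of the images of the sum and the difference from both faces gives `a (1 ∓ c)
= a' (1 ∓ d)`; adding the two yields `a = a'`, then `c = d`. -/
theorem IsFaceForm.symm (hf₁ : IsFaceForm T x₁ y₁ h₁) (hf₂ : IsFaceForm T x₂ y₂ h₂)
    (hR : T (rankOne 𝕜 x₁ y₁) ≠ 0)
    (hx₁ : ‖x₁‖ = 1) (hy₁ : ‖y₁‖ = 1) (hx₂ : ‖x₂‖ = 1) (hy₂ : ‖y₂‖ = 1)
    (hx : ⟪x₁, x₂⟫ = 0) (hy : ⟪y₁, y₂⟫ = 0) {c d : ℝ} (hc : 0 ≤ c) (hd : 0 ≤ d) (hc1 : c ≤ 1)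
    (hd1 : d ≤ 1) (h12 : h₁ (rankOne 𝕜 x₂ y₂) = -(c : 𝕜))
    (h21 : h₂ (rankOne 𝕜 x₁ y₁) = -(d : 𝕜)) :
    ‖T (rankOne 𝕜 x₁ y₁)‖ = ‖T (rankOne 𝕜 x₂ y₂)‖ ∧ c = d := by
  have m2 := rankOne_mem_block (𝕜 := 𝕜) hx hy
  have m1 := rankOne_mem_block (𝕜 := 𝕜) (inner_eq_zero_symm.1 hx) (inner_eq_zero_symm.1 hy)
  have n1 : ‖rankOne 𝕜 x₁ y₁‖ ≤ 1 := by simp [hx₁, hy₁]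
  have n2 : ‖rankOne 𝕜 x₂ y₂‖ ≤ 1 := by simp [hx₂, hy₂]
  have e1 := hf₁.norm_map_add m2 n2
  have e2 := hf₂.norm_map_add m1 n1
  have e3 := hf₁.norm_map_add (neg_mem m2) (by rwa [norm_neg])
  have e4 := hf₂.norm_map_add (neg_mem m1) (by rwa [norm_neg])
  rw [add_comm, e1] at e2
  rw [← norm_neg, ← map_neg, neg_add, neg_neg, add_comm, e3] at e4
  rw [map_neg, map_neg] at e4
  have q1 : ∀ r : ℝ, r ≤ 1 → ‖(1 : 𝕜) + -(r : 𝕜)‖ = 1 - r := fun r hr => by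
    rw [← sub_eq_add_neg, ← RCLike.ofReal_one, ← RCLike.ofReal_sub, RCLike.norm_ofReal,
      abs_of_nonneg (by linarith)]
  have q2 : ∀ r : ℝ, 0 ≤ r → ‖(1 : 𝕜) + - -(r : 𝕜)‖ = 1 + r := fun r hr => by
    rw [neg_neg, ← RCLike.ofReal_one, ← RCLike.ofReal_add, RCLike.norm_ofReal,
      abs_of_nonneg (by linarith)]
  rw [h12, h21, q1 _ hc1, q1 _ hd1] at e2
  rw [h12, h21, q2 _ hc, q2 _ hd] at e4
  have ha : ‖T (rankOne 𝕜 x₁ y₁)‖ = ‖T (rankOne 𝕜 x₂ y₂)‖ := by linarith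
  refine ⟨ha, ?_⟩
  rw [← ha] at e4
  have := mul_left_cancel₀ (norm_ne_zero_iff.2 hR) e4
  linarith

/-- A normalized kernel element of least rank must have at least three singular values equal to one,
say with rank one parts `R₁, R₂, R₃`. The mutual values of their face functionals are symmetric and
nonpositive, and `‖T (R₁ + R₂ - R₃)‖` seen from the three faces forces one of them to vanish,
against minimality. -/
theorem injective_of_parallel (hE : 3 ≤ Module.finrank 𝕜 E)
    (hF : 2 ≤ Module.finrank 𝕜 F) (hT : ∀ A B, Parallel A B → Parallel (T A) (T B))
    (hrk : ∀ B, ∃ A, T A ∉ Submodule.span 𝕜 {B}) : Function.Injective T := by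
  have : Nontrivial E := Module.nontrivial_of_finrank_pos (R := 𝕜) (by omega)
  have : Nontrivial F := Module.nontrivial_of_finrank_pos (R := 𝕜) (by omega)
  have hne : ∀ {x : F} {y : E}, ‖x‖ = 1 → ‖y‖ = 1 → T (rankOne 𝕜 x y) ≠ 0 := fun hx hy =>
    map_rankOne_ne_zero hE hF hT hrk (by rintro rfl; simp at hx) (by rintro rfl; simp at hy)
  have key : ∀ k : ℕ, ∀ A : E →L[𝕜] F, ‖A‖ = 1 →
      Module.finrank 𝕜 A.toLinearMap.range = k → T A ≠ 0 := by
    intro k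
    induction k using Nat.strong_induction_on with
    | _ k ih =>
    intro A hA hk h0
    obtain ⟨x₁, y₁, hx₁, hy₁, A', hA', hAeq, hA'n⟩ := exists_top_decomp A
    rw [hA] at hA'n
    rw [hA, RCLike.ofReal_one, one_smul] at hAeq
    obtain ⟨h₁, hf₁⟩ := exists_isFaceForm hE hF hT hrk hx₁ hy₁
    have hA'h := (hf₁.eq_neg_one (hne hx₁ hy₁) hA' hA'n).1 (by rw [← hAeq, h0])
    have hA'1 : ‖A'‖ = 1 := le_antisymm hA'n (by simpa [hA'h] using hf₁.1 A' hA')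
    obtain ⟨x₂, y₂, hx₂, hy₂, B, hB₂, hA'eq, hBn⟩ := exists_top_decomp A'
    rw [hA'1] at hBn
    rw [hA'1, RCLike.ofReal_one] at hA'eq
    obtain ⟨ox, oy, hB₁⟩ := orthogonal_of_mem_block hx₂ hy₂ one_ne_zero hB₂
      (by rw [← hA'eq]; exact hA')
    rw [one_smul] at hA'eq
    have m2 := rankOne_mem_block (𝕜 := 𝕜) ox oy
    have m1 := rankOne_mem_block (𝕜 := 𝕜) (inner_eq_zero_symm.1 ox) (inner_eq_zero_symm.1 oy)
    have hx₂0 : x₂ ≠ 0 := by rintro rfl; simp at hx₂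
    have hy₂0 : y₂ ≠ 0 := by rintro rfl; simp at hy₂
    -- minimality of the rank
    have hd0 : h₁ (rankOne 𝕜 x₂ y₂) ≠ 0 := by
      intro hd0
      have hlt := finrank_range_lt hx₂0 hy₂0 one_ne_zero (add_mem m1 hB₂)
      have heq : (1 : 𝕜) • rankOne 𝕜 x₂ y₂ + (rankOne 𝕜 x₁ y₁ + B) = A := by
        rw [hAeq, hA'eq, one_smul]; abel
      rw [heq, hk] at hlt
      refine ih _ hlt _ ?_ rfl ((hf₁.eq_neg_one (hne hx₁ hy₁) hB₁ hBn).2 ?_)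
      · refine le_antisymm (norm_rankOne_add_le hx₁ hy₁ hB₁ hBn) ?_
        have := norm_inner_apply_le hx₁ hy₁ (rankOne 𝕜 x₁ y₁ + B)
        have h2 := inner_smul_rankOne_add_apply hx₁ hy₁ 1 hB₁
        rw [one_smul] at h2
        rwa [h2, norm_one] at this
      · rw [hA'eq, map_add, hd0, zero_add] at hA'h
        exact hA'h
    have he0 : h₁ B ≠ 0 := by
      intro he0
      rw [hA'eq, map_add, he0, add_zero] at hA'h
      exact map_rankOne_add_rankOne_ne_zero hE hF hT hrk hx₁ hy₁ hx₂ hy₂ ox oy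
        ((hf₁.eq_neg_one (hne hx₁ hy₁) m2 (by simp [hx₂, hy₂])).2 hA'h)
    have hB0 : B ≠ 0 := by rintro rfl; simp at he0
    have hBpos : 0 < ‖B‖ := norm_pos_iff.2 hB0
    have hB1 : ‖B‖ = 1 := by
      refine le_antisymm hBn ?_
      -- If `‖B‖ < 1`, enlarging `B` to norm one would push the functional, already of modulus one,
      -- beyond its bound.
      have h1 := hf₁.norm_add_le hx₂ hy₂ ox oy hB₁ hB₂ (r := ‖B‖⁻¹) (by positivity)
        (inv_mul_cancel₀ hBpos.ne').le
      have h2 : 1 ≤ ‖h₁ (rankOne 𝕜 x₂ y₂)‖ + ‖h₁ B‖ := by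
        rw [hA'eq, map_add] at hA'h
        have := norm_add_le (h₁ (rankOne 𝕜 x₂ y₂)) (h₁ B)
        rwa [hA'h, norm_neg, norm_one] at this
      have h3 : ‖B‖⁻¹ ≤ 1 := by
        have := norm_pos_iff.2 he0
        by_contra! h
        nlinarith
      exact (inv_le_one₀ hBpos).1 h3
    obtain ⟨x₃, y₃, hx₃, hy₃, Z, hZ₃, hBeq, hZn⟩ := exists_top_decomp B
    rw [hB1] at hZn
    rw [hB1, RCLike.ofReal_one] at hBeq
    obtain ⟨ox13, oy13, hZ₁⟩ := orthogonal_of_mem_block hx₃ hy₃ one_ne_zero hZ₃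
      (by rw [← hBeq]; exact hB₁)
    obtain ⟨ox23, oy23, hZ₂⟩ := orthogonal_of_mem_block hx₃ hy₃ one_ne_zero hZ₃
      (by rw [← hBeq]; exact hB₂)
    rw [one_smul] at hBeq
    obtain ⟨h₂, hf₂⟩ := exists_isFaceForm hE hF hT hrk hx₂ hy₂
    obtain ⟨h₃, hf₃⟩ := exists_isFaceForm hE hF hT hrk hx₃ hy₃
    have ox' := inner_eq_zero_symm.1 ox
    have oy' := inner_eq_zero_symm.1 oy
    have ox31 := inner_eq_zero_symm.1 ox13
    have oy31 := inner_eq_zero_symm.1 oy13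
    have ox32 := inner_eq_zero_symm.1 ox23
    have oy32 := inner_eq_zero_symm.1 oy23
    have sum : ∀ C, C = A → T C = 0 := fun C hC => by rw [hC, h0]
    have b1 : rankOne 𝕜 x₁ y₁ + Z ∈ block x₂ y₂ ∧ rankOne 𝕜 x₁ y₁ + Z ∈ block x₃ y₃ ∧
        ‖rankOne 𝕜 x₁ y₁ + Z‖ ≤ 1 := ⟨add_mem m1 hZ₂, add_mem (rankOne_mem_block ox31 oy31) hZ₃,
      norm_rankOne_add_le hx₁ hy₁ hZ₁ hZn⟩
    have b2 : rankOne 𝕜 x₂ y₂ + Z ∈ block x₁ y₁ ∧ rankOne 𝕜 x₂ y₂ + Z ∈ block x₃ y₃ ∧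
        ‖rankOne 𝕜 x₂ y₂ + Z‖ ≤ 1 := ⟨add_mem m2 hZ₁, add_mem (rankOne_mem_block ox32 oy32) hZ₃,
      norm_rankOne_add_le hx₂ hy₂ hZ₂ hZn⟩
    obtain ⟨d12, n12⟩ := hf₁.eq_neg_norm (hne hx₁ hy₁) hx₂ hy₂ ox oy hB₁ hB₂ hBn
      (sum _ (by rw [hAeq, hA'eq]))
    obtain ⟨d13, n13⟩ := hf₁.eq_neg_norm (hne hx₁ hy₁) hx₃ hy₃ ox13 oy13 b2.1 b2.2.1 b2.2.2
      (sum _ (by rw [hAeq, hA'eq, hBeq]; abel))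
    obtain ⟨d21, n21⟩ := hf₂.eq_neg_norm (hne hx₂ hy₂) hx₁ hy₁ ox' oy' hB₂ hB₁ hBn
      (sum _ (by rw [hAeq, hA'eq]; abel))
    obtain ⟨d23, n23⟩ := hf₂.eq_neg_norm (hne hx₂ hy₂) hx₃ hy₃ ox23 oy23 b1.1 b1.2.1 b1.2.2
      (sum _ (by rw [hAeq, hA'eq, hBeq]; abel))
    obtain ⟨d31, n31⟩ := hf₃.eq_neg_norm (hne hx₃ hy₃) hx₁ hy₁ ox31 oy31 b2.2.1 b2.1 b2.2.2
      (sum _ (by rw [hAeq, hA'eq, hBeq]; abel))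
    obtain ⟨d32, n32⟩ := hf₃.eq_neg_norm (hne hx₃ hy₃) hx₂ hy₂ ox32 oy32 b1.2.1 b1.1 b1.2.2
      (sum _ (by rw [hAeq, hA'eq, hBeq]; abel))
    obtain ⟨a12, s12⟩ := hf₁.symm hf₂ (hne hx₁ hy₁) hx₁ hy₁ hx₂ hy₂ ox oy (norm_nonneg _)
      (norm_nonneg _) n12 n21 d12 d21
    obtain ⟨a13, s13⟩ := hf₁.symm hf₃ (hne hx₁ hy₁) hx₁ hy₁ hx₃ hy₃ ox13 oy13 (norm_nonneg _)
      (norm_nonneg _) n13 n31 d13 d31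
    obtain ⟨a23, s23⟩ := hf₂.symm hf₃ (hne hx₂ hy₂) hx₂ hy₂ hx₃ hy₃ ox23 oy23 (norm_nonneg _)
      (norm_nonneg _) n23 n32 d23 d32
    have n1 : ‖rankOne 𝕜 x₁ y₁‖ ≤ 1 := by simp [hx₁, hy₁]
    have n3 : ‖-rankOne 𝕜 x₃ y₃‖ ≤ 1 := by simp [hx₃, hy₃]
    have m13 := neg_mem (rankOne_mem_block (𝕜 := 𝕜) ox13 oy13)
    have m23 := neg_mem (rankOne_mem_block (𝕜 := 𝕜) ox23 oy23)
    have m31 := rankOne_mem_block (𝕜 := 𝕜) ox31 oy31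
    have m32 := rankOne_mem_block (𝕜 := 𝕜) ox32 oy32
    -- The three evaluations will read `1 - p + q = 1 - p + r = 1 + q + r`, so `p = -r`, and both
    -- are nonnegative.
    have e1 := hf₁.norm_map_add (add_mem m2 m13) (norm_rankOne_add_le hx₂ hy₂ m23 n3)
    have e2 := hf₂.norm_map_add (add_mem m1 m23) (norm_rankOne_add_le hx₁ hy₁ m13 n3)
    have e3 := hf₃.norm_map_add (neg_mem (add_mem m31 m32)) (by
      rw [norm_neg, add_comm]; exact norm_rankOne_add_le hx₂ hy₂ m1 n1)
    rw [show rankOne 𝕜 x₂ y₂ + (rankOne 𝕜 x₁ y₁ + -rankOne 𝕜 x₃ y₃)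
      = rankOne 𝕜 x₁ y₁ + (rankOne 𝕜 x₂ y₂ + -rankOne 𝕜 x₃ y₃) by abel] at e2
    rw [show rankOne 𝕜 x₃ y₃ + -(rankOne 𝕜 x₁ y₁ + rankOne 𝕜 x₂ y₂)
      = -(rankOne 𝕜 x₁ y₁ + (rankOne 𝕜 x₂ y₂ + -rankOne 𝕜 x₃ y₃)) by abel, map_neg, norm_neg] at e3
    rw [e1] at e2 e3
    rw [← a12] at e2
    rw [← a13] at e3
    have hR := norm_ne_zero_iff.2 (hne hx₁ hy₁)
    have f2 := mul_left_cancel₀ hR e2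
    have f3 := mul_left_cancel₀ hR e3
    have norm_real : ∀ r : ℝ, 0 ≤ r → ‖(r : 𝕜)‖ = r := fun r hr => by
      rw [RCLike.norm_ofReal, abs_of_nonneg hr]
    set p := ‖h₁ (rankOne 𝕜 x₂ y₂)‖
    set q := ‖h₁ (rankOne 𝕜 x₃ y₃)‖
    set r := ‖h₂ (rankOne 𝕜 x₃ y₃)‖
    have hp : 0 ≤ p := norm_nonneg _
    have hq : 0 ≤ q := norm_nonneg _
    have hr : 0 ≤ r := norm_nonneg _
    rw [← s12] at d21
    rw [← s13] at d31
    rw [← s23] at d32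
    rw [map_add, map_neg, map_add, map_neg, d12, d13, d21, d23] at f2
    rw [map_add, map_neg, map_neg, map_add, d12, d13, d31, d32] at f3
    rw [show (1 : 𝕜) + (-(p : 𝕜) + - -(q : 𝕜)) = ((1 - p + q : ℝ) : 𝕜) by push_cast; ring,
      norm_real _ (by linarith)] at f2 f3
    rw [show (1 : 𝕜) + (-(p : 𝕜) + - -(r : 𝕜)) = ((1 - p + r : ℝ) : 𝕜) by push_cast; ring,
      norm_real _ (by linarith)] at f2
    rw [show (1 : 𝕜) + -(-(q : 𝕜) + -(r : 𝕜)) = ((1 + q + r : ℝ) : 𝕜) by push_cast; ring,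
      norm_real _ (by linarith)] at f3
    exact hd0 (norm_eq_zero.1 (by change p = 0; linarith))
  rw [injective_iff_map_eq_zero]
  intro A hA
  by_contra hA0
  have hn : ‖A‖ ≠ 0 := norm_ne_zero_iff.2 hA0
  exact key _ (((‖A‖⁻¹ : ℝ) : 𝕜) • A) (by simp [norm_smul, hn]) rfl (by rw [map_smul, hA, smul_zero])

end Injective

/-! ### Preservation of rank one operators and orthogonality -/

section RankOne

theorem inner_apply_of_mem_aligned {u : F} {v : E} (hu : ‖u‖ = 1) (hv : ‖v‖ = 1)
    {N : E →L[𝕜] F} (hN : N ∈ aligned u v) (z : E) : ⟪u, N z⟫ = ⟪u, N v⟫ * ⟪v, z⟫ := by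
  obtain ⟨β, X, hX, rfl⟩ := exists_aligned_decomp (by rintro rfl; simp at hv) hN
  rw [inner_smul_rankOne_add_apply hu hv β hX]
  simp [inner_add_right, inner_smul_right, hX.2, inner_self_eq_norm_sq_to_K, hu]

theorem apply_of_mem_aligned {u : F} {v : E} (hu : ‖u‖ = 1) (hv : ‖v‖ = 1)
    {N : E →L[𝕜] F} (hN : N ∈ aligned u v) : N v = ⟪u, N v⟫ • u := by
  obtain ⟨β, X, hX, rfl⟩ := exists_aligned_decomp (by rintro rfl; simp at hv) hN
  rw [inner_smul_rankOne_add_apply hu hv β hX]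
  simp [hX.1, hv]

theorem exists_linearIsometryEquiv_apply_eq {x u : F} (hx : ‖x‖ = 1) (hu : ‖u‖ = 1) :
    ∃ W : F ≃ₗᵢ[𝕜] F, W x = u := by
  have : Nontrivial F := ⟨x, 0, by rintro rfl; simp at hx⟩
  have hpos : 0 < Module.finrank 𝕜 F := Module.finrank_pos
  have h : ∀ {a : F}, ‖a‖ = 1 → ∃ b : OrthonormalBasis (Fin (Module.finrank 𝕜 F)) 𝕜 F,
      b ⟨0, hpos⟩ = a := by
    intro a ha
    obtain ⟨b, hb⟩ := Orthonormal.exists_orthonormalBasis_extension_of_card_eq (𝕜 := 𝕜)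
      (ι := Fin (Module.finrank 𝕜 F)) (by simp) (v := fun _ => a) (s := {⟨0, hpos⟩})
      ⟨fun i => ha, fun i j hij => absurd (Subsingleton.elim i j) hij⟩
    exact ⟨b, hb _ rfl⟩
  obtain ⟨b, hb⟩ := h hx
  obtain ⟨b', hb'⟩ := h hu
  exact ⟨b.equiv b' (Equiv.refl _), by rw [← hb, OrthonormalBasis.equiv_apply_basis, ← hb']; rfl⟩

theorem finrank_aligned_le {x u : F} {y v : E} (hx : ‖x‖ = 1) (hu : ‖u‖ = 1) (hy : ‖y‖ = 1)
    (hv : ‖v‖ = 1) : Module.finrank 𝕜 (aligned (𝕜 := 𝕜) x y)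
      ≤ Module.finrank 𝕜 (aligned (𝕜 := 𝕜) u v) := by
  obtain ⟨W, hW⟩ := exists_linearIsometryEquiv_apply_eq (𝕜 := 𝕜) hx hu
  obtain ⟨V, hV⟩ := exists_linearIsometryEquiv_apply_eq (𝕜 := 𝕜) hv hy
  let Φ : (E →L[𝕜] F) →ₗ[𝕜] (E →L[𝕜] F) :=
    { toFun := fun A => (W : F →L[𝕜] F) ∘L A ∘L (V : E →L[𝕜] E)
      map_add' := fun A B => by ext z; simp
      map_smul' := fun c A => by ext z; simp }
  have hΦ : ∀ A z, Φ A z = W (A (V z)) := fun A z => rfl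
  have hinj : Function.Injective Φ := by
    rw [injective_iff_map_eq_zero]
    intro A hA
    ext z
    have := hΦ A (V.symm z)
    rw [hA, V.apply_symm_apply] at this
    simpa using this.symm
  rw [(Submodule.equivMapOfInjective Φ hinj (aligned x y)).finrank_eq]
  refine Submodule.finrank_mono ?_
  rintro _ ⟨A, ⟨⟨c, hc⟩, hA⟩, rfl⟩
  refine ⟨⟨c, by rw [hΦ, hV, hc, map_smul, hW]⟩, fun z hz => ?_⟩
  rw [hΦ, ← hW, W.inner_map_map]
  refine hA _ ?_
  rw [← hV, V.inner_map_map, hz]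

theorem exists_smul_of_rankOne_eq {u u₀ : F} {v v₀ : E} {c : 𝕜} (hu : u ≠ 0) (hv : v ≠ 0)
    (hv₀ : v₀ ≠ 0) (h : rankOne 𝕜 u v = c • rankOne 𝕜 u₀ v₀) :
    (∃ a : 𝕜, u = a • u₀) ∧ ∃ b : 𝕜, v = b • v₀ := by
  have hvv : ⟪v, v⟫ ≠ 0 := inner_self_ne_zero.2 hv
  have happ : ∀ z, ⟪v, z⟫ • u = c • ⟪v₀, z⟫ • u₀ := fun z => by
    have := congrArg (fun A : E →L[𝕜] F => A z) h
    simpa only [rankOne_apply, smul_apply] using this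
  refine ⟨⟨⟪v, v⟫⁻¹ * (c * ⟪v₀, v⟫), ?_⟩, ?_⟩
  · rw [mul_smul, mul_smul, ← happ, smul_smul, inv_mul_cancel₀ hvv, one_smul]
  · obtain ⟨b, w, hw, hvw⟩ := exists_decomp (𝕜 := 𝕜) hv₀ v
    have h1 := happ w
    rw [hw, zero_smul, smul_zero, smul_eq_zero, or_iff_left hu, hvw, inner_add_left,
      inner_smul_left, hw, mul_zero, zero_add, inner_self_eq_zero] at h1
    exact ⟨b, by rw [hvw, h1, add_zero]⟩

variable {T : (E →L[𝕜] F) →ₗ[𝕜] (E →L[𝕜] F)}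

/-- Injective maps sending rank one operators to rank one operators, and pairs of rank one
operators with orthogonal ranges and supports to pairs of the same kind. -/
structure PreservesOrthogonalRankOne (T : (E →L[𝕜] F) →ₗ[𝕜] (E →L[𝕜] F)) : Prop where
  injective : Function.Injective T
  exists_eq : ∀ x y, ∃ u v, T (rankOne 𝕜 x y) = rankOne 𝕜 u v
  orthogonal : ∀ {x x' u u' : F} {y y' v v' : E}, x ≠ 0 → x' ≠ 0 → y ≠ 0 → y' ≠ 0 →
    ⟪x, x'⟫ = 0 → ⟪y, y'⟫ = 0 → T (rankOne 𝕜 x y) = rankOne 𝕜 u v →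
    T (rankOne 𝕜 x' y') = rankOne 𝕜 u' v' → ⟪u, u'⟫ = 0 ∧ ⟪v, v'⟫ = 0

/-- In case of equality a unimodular multiple of the second operator cancels the first in `coeff`,
and their sum, still in the face, is killed by `T`. -/
theorem Carries.norm_coeff_lt {x x' u : F} {y y' v : E} (hinj : Function.Injective T)
    (hx : ‖x‖ = 1) (hy : ‖y‖ = 1)
    (hx' : ‖x'‖ = 1) (hy' : ‖y'‖ = 1) (hxx : ⟪x, x'⟫ = 0) (hyy : ⟪y, y'⟫ = 0)
    (hthin : ¬ Thin T x y) (h : Carries T x y u v) :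
    ‖coeff T u v (rankOne 𝕜 x' y')‖ < ‖coeff T u v (rankOne 𝕜 x y)‖ := by
  have hx0 : x ≠ 0 := by rintro rfl; simp at hx
  have hy0 : y ≠ 0 := by rintro rfl; simp at hy
  have hm := rankOne_mem_block (𝕜 := 𝕜) hxx hyy
  have h1 := h.norm_coeff_le hx hy hthin hm
  rw [← h.norm_coeff_rankOne hx hy, norm_rankOne, hx', hy', one_mul, one_mul] at h1
  refine lt_of_le_of_ne h1 fun heq => ?_
  set α := coeff T u v (rankOne 𝕜 x y) with hα
  set β := coeff T u v (rankOne 𝕜 x' y')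
  have hα0 : α ≠ 0 := by
    rw [← norm_ne_zero_iff, hα, h.norm_coeff_rankOne hx hy, norm_ne_zero_iff]
    exact fun h0 => rankOne_ne_zero hx0 hy0 (hinj (by rw [h0, map_zero]))
  have hβ0 : β ≠ 0 := by rwa [← norm_ne_zero_iff, heq, norm_ne_zero_iff]
  have hm' := Submodule.smul_mem _ (-(α / β)) hm
  have h2 := h.norm_coeff (attains_rankOne_add hx hy hm' (by
    rw [norm_smul, norm_neg, norm_div, heq, div_self (norm_ne_zero_iff.2 hα0), norm_rankOne, hx',
      hy', one_mul, one_mul]))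
  rw [map_add, map_smul] at h2
  change ‖α + -(α / β) * β‖ = _ at h2
  rw [neg_mul, div_mul_cancel₀ _ hβ0, add_neg_cancel, norm_zero, eq_comm, norm_eq_zero] at h2
  have h3 : rankOne 𝕜 x y + (-(α / β)) • rankOne 𝕜 x' y' = 0 := hinj (by rw [h2, map_zero])
  have h4 := inner_smul_rankOne_add_apply hx hy 1 hm'
  rw [one_smul, h3] at h4
  simp at h4

theorem Carries.orthogonal {x x' u u' : F} {y y' v v' : E} (hinj : Function.Injective T)
    (hx : ‖x‖ = 1) (hy : ‖y‖ = 1)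
    (hx' : ‖x'‖ = 1) (hy' : ‖y'‖ = 1) (hxx : ⟪x, x'⟫ = 0) (hyy : ⟪y, y'⟫ = 0)
    (hthin : ¬ Thin T x y) (hthin' : ¬ Thin T x' y') (h : Carries T x y u v)
    (h' : Carries T x' y' u' v') : ⟪u, u'⟫ = 0 ∧ ⟪v, v'⟫ = 0 := by
  have hxx' := inner_eq_zero_symm.1 hxx
  have hyy' := inner_eq_zero_symm.1 hyy
  -- `⟪u', N v⟫` computed from either alignment. It is applied to the images of both rank one
  -- operators, each aligned with both target pairs.
  have key : ∀ N, N ∈ aligned u v → N ∈ aligned u' v' →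
      ⟪u, N v⟫ * ⟪u', u⟫ = ⟪u', N v'⟫ * ⟪v', v⟫ := fun N h1 h2 => by
    rw [← inner_apply_of_mem_aligned h'.1 h'.2.1 h2, apply_of_mem_aligned h.1 h.2.1 h1,
      inner_smul_right, inner_smul_right, inner_self_eq_norm_sq_to_K, h.1]
    simp
  have k1 := key _ (h.map_mem_aligned hx hy (rankOne_mem_aligned x y))
    (h'.map_mem_aligned hx' hy' (block_le_aligned _ _ (rankOne_mem_block hxx' hyy')))
  have k2 := key _ (h.map_mem_aligned hx hy (block_le_aligned _ _ (rankOne_mem_block hxx hyy)))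
    (h'.map_mem_aligned hx' hy' (rankOne_mem_aligned x' y'))
  have l1 := h.norm_coeff_lt hinj hx hy hx' hy' hxx hyy hthin
  have l2 := h'.norm_coeff_lt hinj hx' hy' hx hy hxx' hyy' hthin'
  have l3 := norm_inner_apply_le h'.1 h'.2.1 (T (rankOne 𝕜 x y))
  have l4 := norm_inner_apply_le h.1 h.2.1 (T (rankOne 𝕜 x' y'))
  rw [← h.norm_coeff_rankOne hx hy] at l3
  rw [← h'.norm_coeff_rankOne hx' hy'] at l4
  have k1' := congrArg norm k1
  have k2' := congrArg norm k2
  simp only [norm_mul] at k1' k2'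
  simp only [coeff_apply] at l1 l2 l3 l4
  set a := ‖⟪u, T (rankOne 𝕜 x y) v⟫‖
  set b := ‖⟪u, T (rankOne 𝕜 x' y') v⟫‖
  set a' := ‖⟪u', T (rankOne 𝕜 x y) v'⟫‖
  set b' := ‖⟪u', T (rankOne 𝕜 x' y') v'⟫‖
  have ha' : 0 ≤ a' := norm_nonneg _
  have hb : 0 ≤ b := norm_nonneg _
  have hU : 0 ≤ ‖⟪u', u⟫‖ := norm_nonneg _
  have hV : 0 ≤ ‖⟪v', v⟫‖ := norm_nonneg _
  have hV0 : ‖⟪v', v⟫‖ = 0 := by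
    by_contra hne
    have hVpos := lt_of_le_of_ne hV (Ne.symm hne)
    have h1 : ‖⟪u', u⟫‖ ≤ ‖⟪v', v⟫‖ := by
      by_contra! hlt
      nlinarith
    have h2 : b' ≤ b := by
      by_contra! hlt
      nlinarith
    have h3 : b = b' := le_antisymm l4 h2
    have h4 : ‖⟪u', u⟫‖ = ‖⟪v', v⟫‖ := by
      rw [h3] at k2'
      exact mul_left_cancel₀ (by linarith) k2'
    rw [h4] at k1'
    have := mul_right_cancel₀ hne k1'
    linarith
  have hU0 : ‖⟪u', u⟫‖ = 0 := by
    rw [hV0, mul_zero, mul_eq_zero] at k1'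
    exact k1'.resolve_left (by linarith)
  exact ⟨inner_eq_zero_symm.1 (norm_eq_zero.1 hU0), inner_eq_zero_symm.1 (norm_eq_zero.1 hV0)⟩

/-- An operator aligned with all pairs orthogonal to `(x, y)` is a multiple of `rankOne x y`. -/
theorem eq_smul_rankOne_of_mem_aligned (hE : 3 ≤ Module.finrank 𝕜 E)
    (hF : 2 ≤ Module.finrank 𝕜 F) {x : F} {y : E} (hx : ‖x‖ = 1) (hy : ‖y‖ = 1) {B : E →L[𝕜] F}
    (hB : ∀ x' y', x' ≠ 0 → y' ≠ 0 → ⟪x, x'⟫ = 0 → ⟪y, y'⟫ = 0 → B ∈ aligned x' y') :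
    ∃ c : 𝕜, B = c • rankOne 𝕜 x y := by
  have hx0 : x ≠ 0 := by rintro rfl; simp at hx
  have hy0 : y ≠ 0 := by rintro rfl; simp at hy
  have h1 : ∀ x', ⟪x, x'⟫ = 0 → ∀ z, ⟪x', B z⟫ = 0 := by
    intro x' hx' z
    by_cases h0 : x' = 0
    · simp [h0]
    obtain ⟨y', hy', hyy, hzy⟩ := exists_orthogonal_pair (𝕜 := 𝕜) hE y z
    exact (hB x' y' h0 hy' hx' hyy).2 z (inner_eq_zero_symm.1 hzy)
  have h2 : ∀ y', ⟪y, y'⟫ = 0 → B y' = 0 := by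
    intro y' hy'
    by_cases h0 : y' = 0
    · simp [h0]
    obtain ⟨x', hx', hxx⟩ := exists_orthogonal (𝕜 := 𝕜) hF x
    obtain ⟨c, hc⟩ := (hB x' y' hx' h0 hxx hy').1
    have h3 := h1 x' hxx y'
    rw [hc, inner_smul_right, mul_eq_zero, inner_self_eq_zero, or_iff_left hx'] at h3
    rw [hc, h3, zero_smul]
  obtain ⟨a, w, hw, haw⟩ := exists_decomp (𝕜 := 𝕜) hx0 (B y)
  have hw0 : w = 0 := by
    have h3 := h1 w hw y
    rwa [haw, inner_add_right, inner_smul_right, inner_eq_zero_symm.1 hw, mul_zero, zero_add,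
      inner_self_eq_zero] at h3
  refine ⟨a, ?_⟩
  ext z
  obtain ⟨b, w', hw', rfl⟩ := exists_decomp (𝕜 := 𝕜) hy0 z
  rw [map_add, h2 w' hw', map_smul, haw, hw0, smul_apply, rankOne_apply, inner_add_right,
    inner_smul_right, hw', inner_self_eq_norm_sq_to_K, hy]
  simp [smul_smul, mul_comm]

/-- By dimension count `T` maps aligned spaces onto aligned spaces. Hence the preimage of `rankOne 𝕜
u v` is aligned with every pair orthogonal to `(x, y)`, which makes it a multiple of `rankOne 𝕜 x
y`. -/
theorem preservesOrthogonalRankOne_of_parallel (hE : 3 ≤ Module.finrank 𝕜 E)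
    (hF : 2 ≤ Module.finrank 𝕜 F) (hT : ∀ A B, Parallel A B → Parallel (T A) (T B))
    (hrk : ∀ B, ∃ A, T A ∉ Submodule.span 𝕜 {B}) : PreservesOrthogonalRankOne T := by
  have : Nontrivial E := Module.nontrivial_of_finrank_pos (R := 𝕜) (by omega)
  have : Nontrivial F := Module.nontrivial_of_finrank_pos (R := 𝕜) (by omega)
  have hinj := injective_of_parallel hE hF hT hrk
  have hsurj : Function.Surjective T := LinearMap.injective_iff_surjective.1 hinj
  have hF0 : ∀ {a : F}, ‖a‖ = 1 → a ≠ 0 := by rintro a ha rfl; simp at ha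
  have hE0 : ∀ {a : E}, ‖a‖ = 1 → a ≠ 0 := by rintro a ha rfl; simp at ha
  have hthin : ∀ {x : F} {y : E}, ‖x‖ = 1 → ‖y‖ = 1 → ¬ Thin T x y := fun hx hy =>
    not_thin hE hF hT hrk (hF0 hx) (hE0 hy)
  have hmap : ∀ {x u : F} {y v : E}, ‖x‖ = 1 → ‖y‖ = 1 → Carries T x y u v →
      (aligned x y).map T = aligned u v := by
    intro x u y v hx hy h
    refine Submodule.eq_of_le_of_finrank_le ?_ ?_
    · rintro _ ⟨A, hA, rfl⟩
      exact h.map_mem_aligned hx hy hA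
    · rw [← (Submodule.equivMapOfInjective T hinj (aligned x y)).finrank_eq]
      exact finrank_aligned_le h.1 hx h.2.1 hy
  have hunitF : ∀ {a : F}, a ≠ 0 → ∃ c : 𝕜, c ≠ 0 ∧ ‖c • a‖ = 1 := fun {a} ha =>
    ⟨((‖a‖⁻¹ : ℝ) : 𝕜), by simpa using ha, by simp [norm_smul, norm_ne_zero_iff.2 ha]⟩
  have hunitE : ∀ {a : E}, a ≠ 0 → ∃ c : 𝕜, c ≠ 0 ∧ ‖c • a‖ = 1 := fun {a} ha =>
    ⟨((‖a‖⁻¹ : ℝ) : 𝕜), by simpa using ha, by simp [norm_smul, norm_ne_zero_iff.2 ha]⟩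
  have hrank : ∀ {x u : F} {y v : E}, ‖x‖ = 1 → ‖y‖ = 1 → Carries T x y u v →
      ∃ c : 𝕜, T (rankOne 𝕜 x y) = c • rankOne 𝕜 u v := by
    intro x u y v hx hy h
    obtain ⟨B, hB⟩ := hsurj (rankOne 𝕜 u v)
    obtain ⟨c, rfl⟩ := eq_smul_rankOne_of_mem_aligned hE hF hx hy (B := B) (by
      intro x' y' hx' hy' hxx hyy
      obtain ⟨a, ha, hax⟩ := hunitF hx'
      obtain ⟨b, hb, hby⟩ := hunitE hy'
      rw [← aligned_smul ha hb]
      obtain ⟨u', v', h'⟩ := exists_carries hT hax hby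
      obtain ⟨ou, ov⟩ := h.orthogonal hinj hx hy hax hby (by rw [inner_smul_right, hxx, mul_zero])
        (by rw [inner_smul_right, hyy, mul_zero]) (hthin hx hy) (hthin hax hby) h'
      have hm : rankOne 𝕜 u v ∈ aligned u' v' := block_le_aligned _ _
        (rankOne_mem_block (inner_eq_zero_symm.1 ou) (inner_eq_zero_symm.1 ov))
      rw [← hmap hax hby h'] at hm
      obtain ⟨B', hB', hBB⟩ := hm
      rwa [← hinj (hBB.trans hB.symm)])
    have hc : c ≠ 0 := by
      rintro rfl
      rw [zero_smul, map_zero] at hB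
      exact rankOne_ne_zero (𝕜 := 𝕜) (hF0 h.1) (hE0 h.2.1) hB.symm
    exact ⟨c⁻¹, by rw [← hB, map_smul, smul_smul, inv_mul_cancel₀ hc, one_smul]⟩
  have hgen : ∀ {x : F} {y : E}, x ≠ 0 → y ≠ 0 → ∃ a b : 𝕜, ‖a • x‖ = 1 ∧ ‖b • y‖ = 1 ∧
      ∃ u v, Carries T (a • x) (b • y) u v ∧ ∃ c : 𝕜, T (rankOne 𝕜 x y) = c • rankOne 𝕜 u v := by
    intro x y hx hy
    obtain ⟨a, ha, hax⟩ := hunitF hx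
    obtain ⟨b, hb, hby⟩ := hunitE hy
    obtain ⟨u, v, h⟩ := exists_carries hT hax hby
    obtain ⟨c, hc⟩ := hrank hax hby h
    refine ⟨a, b, hax, hby, u, v, h, (a * starRingEnd 𝕜 b)⁻¹ * c, ?_⟩
    have hs : rankOne 𝕜 (a • x) (b • y) = (a * starRingEnd 𝕜 b) • rankOne 𝕜 x y := by
      simp [smul_smul]
    rw [mul_smul, ← hc, hs, map_smul, smul_smul,
      inv_mul_cancel₀ (mul_ne_zero ha (by simpa using hb)), one_smul]
  refine ⟨hinj, fun x y => ?_, ?_⟩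
  · by_cases hx : x = 0
    · exact ⟨0, 0, by simp [hx]⟩
    by_cases hy : y = 0
    · exact ⟨0, 0, by simp [hy]⟩
    obtain ⟨a, b, -, -, u, v, -, c, hc⟩ := hgen hx hy
    exact ⟨c • u, v, by rw [hc]; simp⟩
  · intro x x' u u' y y' v v' hx hx' hy hy' hxx hyy e e'
    obtain ⟨a, b, na, nb, u₀, v₀, h, c, hc⟩ := hgen hx hy
    obtain ⟨a', b', na', nb', u₀', v₀', h', c', hc'⟩ := hgen hx' hy'
    obtain ⟨ou, ov⟩ := h.orthogonal hinj na nb na' nb'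
      (by rw [inner_smul_right, inner_smul_left, hxx, mul_zero, mul_zero])
      (by rw [inner_smul_right, inner_smul_left, hyy, mul_zero, mul_zero])
      (hthin na nb) (hthin na' nb') h'
    have hne : ∀ {x u : F} {y v : E}, x ≠ 0 → y ≠ 0 → T (rankOne 𝕜 x y) = rankOne 𝕜 u v →
        u ≠ 0 ∧ v ≠ 0 := by
      intro x u y v hx hy h
      have : rankOne 𝕜 u v ≠ 0 := fun h0 =>
        rankOne_ne_zero hx hy (hinj (by rw [h, h0, map_zero]))
      rwa [Ne, rankOne_eq_zero, not_or] at this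
    obtain ⟨hu0, hv0⟩ := hne hx hy e
    obtain ⟨hu0', hv0'⟩ := hne hx' hy' e'
    rw [e] at hc
    rw [e'] at hc'
    obtain ⟨⟨p, rfl⟩, q, rfl⟩ := exists_smul_of_rankOne_eq hu0 hv0 (hE0 h.2.1) hc
    obtain ⟨⟨p', rfl⟩, q', rfl⟩ := exists_smul_of_rankOne_eq hu0' hv0' (hE0 h'.2.1) hc'
    exact ⟨by rw [inner_smul_right, inner_smul_left, ou, mul_zero, mul_zero],
      by rw [inner_smul_right, inner_smul_left, ov, mul_zero, mul_zero]⟩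

/-- The conjugate of a map by the adjoint. -/
noncomputable def adjointConj [CompleteSpace E] [CompleteSpace F]
    (T : (E →L[𝕜] F) →ₗ[𝕜] (E →L[𝕜] F)) : (F →L[𝕜] E) →ₗ[𝕜] (F →L[𝕜] E) where
  toFun A := ContinuousLinearMap.adjoint (T (ContinuousLinearMap.adjoint A))
  map_add' A B := by simp
  map_smul' c A := by
    rw [map_smulₛₗ, map_smul, map_smulₛₗ]
    simp

theorem adjointConj_apply [CompleteSpace E] [CompleteSpace F] (A : F →L[𝕜] E) :
    adjointConj T A = ContinuousLinearMap.adjoint (T (ContinuousLinearMap.adjoint A)) := rfl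

theorem Parallel.adjoint [CompleteSpace E] [CompleteSpace F] {A B : E →L[𝕜] F}
    (h : Parallel A B) :
    Parallel (ContinuousLinearMap.adjoint A) (ContinuousLinearMap.adjoint B) := by
  obtain ⟨μ, hμ, h⟩ := h
  refine ⟨starRingEnd 𝕜 μ, by simpa using hμ, ?_⟩
  rw [← map_smulₛₗ, ← map_add]
  simpa only [LinearIsometryEquiv.norm_map] using h

theorem preservesOrthogonalRankOne_of_parallel' (hE : 2 ≤ Module.finrank 𝕜 E)
    (hF : 2 ≤ Module.finrank 𝕜 F) (hEF : 3 ≤ Module.finrank 𝕜 E ∨ 3 ≤ Module.finrank 𝕜 F)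
    (hT : ∀ A B, Parallel A B → Parallel (T A) (T B))
    (hrk : ∀ B, ∃ A, T A ∉ Submodule.span 𝕜 {B}) : PreservesOrthogonalRankOne T := by
  rcases hEF with h | h
  · exact preservesOrthogonalRankOne_of_parallel h hF hT hrk
  have := FiniteDimensional.complete 𝕜 E
  have := FiniteDimensional.complete 𝕜 F
  have hS := preservesOrthogonalRankOne_of_parallel (T := adjointConj T) h hE
    (fun A B hAB => (hT _ _ hAB.adjoint).adjoint) (fun B => by
      obtain ⟨A, hA⟩ := hrk (ContinuousLinearMap.adjoint B)
      refine ⟨ContinuousLinearMap.adjoint A, fun hmem => hA ?_⟩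
      obtain ⟨c, hc⟩ := Submodule.mem_span_singleton.1 hmem
      refine Submodule.mem_span_singleton.2 ⟨starRingEnd 𝕜 c, ?_⟩
      rw [← map_smulₛₗ, hc, adjointConj_apply, ContinuousLinearMap.adjoint_adjoint,
        ContinuousLinearMap.adjoint_adjoint])
  have hTS : ∀ (x : F) (y : E) u v, T (rankOne 𝕜 x y) = rankOne 𝕜 u v ↔
      adjointConj T (rankOne 𝕜 y x) = rankOne 𝕜 v u := by
    intro x y u v
    rw [adjointConj_apply, adjoint_rankOne, ← adjoint_rankOne u v]
    exact (ContinuousLinearMap.adjoint.injective.eq_iff).symm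
  refine ⟨?_, fun x y => ?_, ?_⟩
  · rw [injective_iff_map_eq_zero]
    intro A hA
    have := (injective_iff_map_eq_zero _).1 hS.injective (ContinuousLinearMap.adjoint A) (by
      rw [adjointConj_apply, ContinuousLinearMap.adjoint_adjoint, hA, map_zero])
    simpa using this
  · obtain ⟨v, u, h⟩ := hS.exists_eq y x
    exact ⟨u, v, (hTS _ _ _ _).2 h⟩
  · intro x x' u u' y y' v v' hx hx' hy hy' hxx hyy e e'
    exact (hS.orthogonal hy hy' hx hx' hyy hxx ((hTS _ _ _ _).1 e) ((hTS _ _ _ _).1 e')).symm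

end RankOne

/-! ### Functionals preserving triangle equality -/

section TEA

variable {T : (E →L[𝕜] F) →ₗ[𝕜] (E →L[𝕜] F)}

/-- With `R = rankOne 𝕜 x y`, triangle equality for `R + X` and `R - X` yields `‖f X‖ ≤ ‖f R‖` for
`X` in the unit ball of the block. Any rank one operator is, up to scaling, such an `X` for some `R`
killed by `f`. -/
theorem eq_zero_of_norm_add (hE : 3 ≤ Module.finrank 𝕜 E) (hF : 2 ≤ Module.finrank 𝕜 F)
    (f : (E →L[𝕜] F) →ₗ[𝕜] 𝕜) (hf : ∀ A B, ‖A + B‖ = ‖A‖ + ‖B‖ → ‖f A + f B‖ = ‖f A‖ + ‖f B‖) :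
    f = 0 := by
  have key : ∀ {x : F} {y : E} {X}, ‖x‖ = 1 → ‖y‖ = 1 → X ∈ block x y → ‖X‖ ≤ 1 →
      ‖f X‖ ≤ ‖f (rankOne 𝕜 x y)‖ := by
    intro x y X hx hy hX hX1
    have hnorm : ∀ Y ∈ block (𝕜 := 𝕜) x y, ‖Y‖ ≤ 1 → ‖rankOne 𝕜 x y + Y‖ = 1 := by
      intro Y hY hY1
      refine le_antisymm (norm_rankOne_add_le hx hy hY hY1) ?_
      have := norm_inner_apply_le hx hy (rankOne 𝕜 x y + Y)
      have h2 := inner_smul_rankOne_add_apply hx hy 1 hY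
      rw [one_smul] at h2
      rwa [h2, norm_one] at this
    have hs : (rankOne 𝕜 x y + X) + (rankOne 𝕜 x y + -X) = (2 : 𝕜) • rankOne 𝕜 x y := by module
    have h1 := hf (rankOne 𝕜 x y + X) (rankOne 𝕜 x y + -X) (by
      rw [hnorm X hX hX1, hnorm _ (neg_mem hX) (by rwa [norm_neg]), hs, norm_smul, norm_rankOne,
        hx, hy, RCLike.norm_two]
      norm_num)
    rw [← map_add, hs, map_smul, norm_smul, RCLike.norm_two] at h1
    have h2 := norm_sub_le (f (rankOne 𝕜 x y + X)) (f (rankOne 𝕜 x y + -X))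
    rw [← map_sub, show (rankOne 𝕜 x y + X) - (rankOne 𝕜 x y + -X) = (2 : 𝕜) • X by module,
      map_smul, norm_smul, RCLike.norm_two] at h2
    linarith
  have hR : ∀ x y, rankOne 𝕜 x y ∈ LinearMap.ker f := by
    intro x y
    rw [LinearMap.mem_ker]
    by_cases hx : x = 0
    · simp [hx]
    by_cases hy : y = 0
    · simp [hy]
    obtain ⟨x', hx', hxx⟩ := exists_orthogonal (𝕜 := 𝕜) hF x
    obtain ⟨y', hy', hyy, hfy⟩ := exists_rankOne_mem_ker hE f x' y
    have hn : ∀ {a : F}, a ≠ 0 → ‖((‖a‖⁻¹ : ℝ) : 𝕜) • a‖ = 1 := fun ha => by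
      simp [norm_smul, norm_ne_zero_iff.2 ha]
    have hnE : ∀ {a : E}, a ≠ 0 → ‖((‖a‖⁻¹ : ℝ) : 𝕜) • a‖ = 1 := fun ha => by
      simp [norm_smul, norm_ne_zero_iff.2 ha]
    have h := key (hn hx') (hnE hy') (X := rankOne 𝕜 (((‖x‖⁻¹ : ℝ) : 𝕜) • x)
      (((‖y‖⁻¹ : ℝ) : 𝕜) • y)) (rankOne_mem_block
        (by rw [inner_smul_left, inner_smul_right, inner_eq_zero_symm.1 hxx, mul_zero, mul_zero])
        (by rw [inner_smul_left, inner_smul_right, inner_eq_zero_symm.1 hyy, mul_zero, mul_zero]))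
      (by rw [norm_rankOne, hn hx, hnE hy, one_mul])
    simp only [map_smul, map_smulₛₗ, smul_apply, hfy, smul_zero, norm_zero, norm_le_zero_iff] at h
    simpa [hx, hy] using h
  ext A
  exact mem_of_forall_rankOne_mem hR A

theorem eq_zero_of_norm_add' (hE : 2 ≤ Module.finrank 𝕜 E)
    (hF : 2 ≤ Module.finrank 𝕜 F) (hEF : 3 ≤ Module.finrank 𝕜 E ∨ 3 ≤ Module.finrank 𝕜 F)
    (f : (E →L[𝕜] F) →ₗ[𝕜] 𝕜) (hf : ∀ A B, ‖A + B‖ = ‖A‖ + ‖B‖ → ‖f A + f B‖ = ‖f A‖ + ‖f B‖) :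
    f = 0 := by
  rcases hEF with h | h
  · exact eq_zero_of_norm_add h hF f hf
  have := FiniteDimensional.complete 𝕜 E
  have := FiniteDimensional.complete 𝕜 F
  let g : (F →L[𝕜] E) →ₗ[𝕜] 𝕜 :=
    { toFun := fun A => starRingEnd 𝕜 (f (ContinuousLinearMap.adjoint A))
      map_add' := by simp
      map_smul' := fun c A => by
        rw [map_smulₛₗ]
        simp }
  have hg : g = 0 := eq_zero_of_norm_add h hE g (fun A B hAB => by
    have := hf (ContinuousLinearMap.adjoint A) (ContinuousLinearMap.adjoint B) (by
      rw [← map_add]; simpa only [LinearIsometryEquiv.norm_map] using hAB)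
    simpa [g, ← map_add] using this)
  ext A
  have := congrArg (fun φ : (F →L[𝕜] E) →ₗ[𝕜] 𝕜 => φ (ContinuousLinearMap.adjoint A)) hg
  simpa [g] using this

end TEA

end ParallelPairs

namespace ParallelPairs

/-! ### Rank one preservers over a field -/

section RankOnePreserver

open Matrix

variable {K ι κ : Type*} [Field K]

theorem exists_minor_ne_zero {p q : ι → K} (hp : p ≠ 0) (h : ¬ ∃ c : K, q = c • p) :
    ∃ i j, p i * q j - p j * q i ≠ 0 := by
  by_contra! hall
  obtain ⟨i, hi⟩ := Function.ne_iff.1 hp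
  have hi' : p i ≠ 0 := hi
  refine h ⟨q i / p i, funext fun j => ?_⟩
  have := hall i j
  simp only [Pi.smul_apply, smul_eq_mul]
  field_simp
  linear_combination this

/-- A 2×2 minor of the sum is the product of a minor of `(p, q)` and a minor of `(r, s)`. -/
theorem dependent_of_vecMulVec_add {p q a : ι → K} {r s b : κ → K} (hp : p ≠ 0) (hr : r ≠ 0)
    (h : vecMulVec p r + vecMulVec q s = vecMulVec a b) :
    (∃ c : K, q = c • p) ∨ ∃ c : K, s = c • r := by
  by_contra! hne
  obtain ⟨i, j, hij⟩ := exists_minor_ne_zero hp (by simpa using hne.1)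
  obtain ⟨k, l, hkl⟩ := exists_minor_ne_zero hr (by simpa using hne.2)
  have e : ∀ i k, p i * r k + q i * s k = a i * b k := fun i k => by
    simpa [vecMulVec_apply] using congrFun (congrFun h i) k
  refine mul_ne_zero hij hkl ?_
  linear_combination (p j * r l + q j * s l) * e i k + a i * b k * e j l
    - (p j * r k + q j * s k) * e i l - a i * b l * e j k

/-- The coefficient matrix with rows `(c, 1)` and `(1, 1)` has determinant `c - 1`, which divides
every 2×2 minor. -/
theorem eq_one_of_vecMulVec_add {p q a : ι → K} {r s b : κ → K} (hq : q ≠ 0) (hs : s ≠ 0)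
    (hpq : ¬ ∃ d : K, p = d • q) (hrs : ¬ ∃ d : K, r = d • s) {c : K}
    (h : c • vecMulVec p r + vecMulVec p s + (vecMulVec q r + vecMulVec q s) = vecMulVec a b) :
    c = 1 := by
  obtain ⟨i, j, hij⟩ := exists_minor_ne_zero hq hpq
  obtain ⟨k, l, hkl⟩ := exists_minor_ne_zero hs hrs
  have e : ∀ i k, c * (p i * r k) + p i * s k + (q i * r k + q i * s k) = a i * b k := fun i k => by
    simpa [vecMulVec_apply] using congrFun (congrFun h i) k
  have key : (c - 1) * ((q i * p j - q j * p i) * (s k * r l - s l * r k)) = 0 := by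
    linear_combination (c * (p j * r l) + p j * s l + (q j * r l + q j * s l)) * e i k
      + a i * b k * e j l - (c * (p j * r k) + p j * s k + (q j * r k + q j * s k)) * e i l
      - a i * b l * e j k
  exact sub_eq_zero.1 ((mul_eq_zero.1 key).resolve_right (mul_ne_zero hij hkl))

theorem vecMulVec_left_cancel {u : ι → K} {w w' : κ → K} (hu : u ≠ 0)
    (h : vecMulVec u w = vecMulVec u w') : w = w' := by
  obtain ⟨i, hi⟩ := Function.ne_iff.1 hu
  funext k
  exact mul_left_cancel₀ hi (by simpa [vecMulVec_apply] using congrFun (congrFun h i) k)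

theorem vecMulVec_right_cancel {u u' : ι → K} {w : κ → K} (hw : w ≠ 0)
    (h : vecMulVec u w = vecMulVec u' w) : u = u' := by
  obtain ⟨k, hk⟩ := Function.ne_iff.1 hw
  funext i
  exact mul_right_cancel₀ hk (by simpa [vecMulVec_apply] using congrFun (congrFun h i) k)

theorem vecMulVec_ne_zero' {u : ι → K} {w : κ → K} (hu : u ≠ 0) (hw : w ≠ 0) :
    vecMulVec u w ≠ 0 := fun h => hw (vecMulVec_left_cancel hu (by
    rw [h]; ext; simp [vecMulVec_apply]))

variable {T : Matrix ι κ K →ₗ[K] Matrix ι κ K}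

/-- A map preserving rank one matrices sends the matrices with a given column space to matrices
with a common column space, or to matrices with a common row space. -/
theorem row_dichotomy (hrk : ∀ x z, ∃ u w, T (vecMulVec x z) = vecMulVec u w) {x u : ι → K}
    {z w : κ → K} (hu : u ≠ 0) (hw : w ≠ 0) (h : T (vecMulVec x z) = vecMulVec u w) :
    (∀ z', ∃ w', T (vecMulVec x z') = vecMulVec u w') ∨
      ∀ z', ∃ u', T (vecMulVec x z') = vecMulVec u' w := by
  have hcov : ∀ z', (∃ w', T (vecMulVec x z') = vecMulVec u w') ∨
      ∃ u', T (vecMulVec x z') = vecMulVec u' w := by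
    intro z'
    obtain ⟨u', w', h'⟩ := hrk x z'
    obtain ⟨a, b, hab⟩ := hrk x (z + z')
    rw [vecMulVec_add, map_add, h, h'] at hab
    rcases dependent_of_vecMulVec_add hu hw hab with ⟨c, rfl⟩ | ⟨c, rfl⟩
    · exact Or.inl ⟨c • w', by rw [h', smul_vecMulVec, vecMulVec_smul]⟩
    · exact Or.inr ⟨c • u', by rw [h', smul_vecMulVec, vecMulVec_smul]⟩
  by_contra! hne
  obtain ⟨⟨z₁, h₁⟩, z₂, h₂⟩ := hne
  obtain ⟨u', hu'⟩ := (hcov z₁).resolve_left (by simpa using h₁)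
  obtain ⟨w', hw'⟩ := (hcov z₂).resolve_right (by simpa using h₂)
  -- A vector space is not the union of two proper subspaces.
  rcases hcov (z₁ + z₂) with ⟨b, hb⟩ | ⟨a, ha⟩
  · rw [vecMulVec_add, map_add, hw', ← eq_sub_iff_add_eq, ← vecMulVec_sub] at hb
    exact h₁ _ hb
  · rw [vecMulVec_add, map_add, hu', ← eq_sub_iff_add_eq', ← sub_vecMulVec] at ha
    exact h₂ _ ha

theorem col_dichotomy (hrk : ∀ x z, ∃ u w, T (vecMulVec x z) = vecMulVec u w) {x u : ι → K}
    {z w : κ → K} (hu : u ≠ 0) (hw : w ≠ 0) (h : T (vecMulVec x z) = vecMulVec u w) :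
    (∀ x', ∃ u', T (vecMulVec x' z) = vecMulVec u' w) ∨
      ∀ x', ∃ w', T (vecMulVec x' z) = vecMulVec u w' := by
  let S : Matrix κ ι K →ₗ[K] Matrix κ ι K :=
    { toFun := fun A => (T Aᵀ)ᵀ
      map_add' := fun A B => by simp
      map_smul' := fun c A => by simp }
  have hS : ∀ x z a b, S (vecMulVec z x) = vecMulVec b a ↔ T (vecMulVec x z) = vecMulVec a b := by
    intro x z a b
    change (T (vecMulVec z x)ᵀ)ᵀ = _ ↔ _
    rw [transpose_vecMulVec, ← transpose_inj, transpose_transpose, transpose_vecMulVec]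
  have := row_dichotomy (T := S) (fun z x => by
    obtain ⟨a, b, h⟩ := hrk x z
    exact ⟨b, a, (hS _ _ _ _).2 h⟩) hw hu ((hS _ _ _ _).2 h)
  simpa only [hS] using this

/-- A map preserving rank one matrices that sends some row of rank one matrices to a row and some
column to a column is a tensor product of linear maps. -/
theorem exists_eq_vecMulVec_map (hinj : Function.Injective T)
    (hrk : ∀ x z, ∃ u w, T (vecMulVec x z) = vecMulVec u w) {x₁ u₁ : ι → K} {z₁ w₁ : κ → K}
    (hx₁ : x₁ ≠ 0) (hz₁ : z₁ ≠ 0) (h₁ : T (vecMulVec x₁ z₁) = vecMulVec u₁ w₁)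
    (hrow : ∀ z, ∃ w, T (vecMulVec x₁ z) = vecMulVec u₁ w)
    (hcol : ∀ x, ∃ u, T (vecMulVec x z₁) = vecMulVec u w₁) :
    ∃ (ψ : (ι → K) →ₗ[K] (ι → K)) (φ : (κ → K) →ₗ[K] (κ → K)),
      ∀ x z, T (vecMulVec x z) = vecMulVec (ψ x) (φ z) := by
  have hT0 : ∀ {x : ι → K} {z : κ → K} {u w}, x ≠ 0 → z ≠ 0 →
      T (vecMulVec x z) = vecMulVec u w → u ≠ 0 ∧ w ≠ 0 := by
    intro x z u w hx hz h
    constructor <;> rintro rfl <;>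
      exact vecMulVec_ne_zero' hx hz (hinj (by
        rw [h, map_zero]; ext; simp [vecMulVec_apply]))
  obtain ⟨hu₁, hw₁⟩ := hT0 hx₁ hz₁ h₁
  choose φ hφ using hrow
  choose ψ hψ using hcol
  let Φ : (κ → K) →ₗ[K] (κ → K) :=
    { toFun := φ
      map_add' := fun a b => vecMulVec_left_cancel hu₁ (by
        rw [← hφ, vecMulVec_add, vecMulVec_add, map_add, hφ, hφ])
      map_smul' := fun c a => vecMulVec_left_cancel hu₁ (by
        rw [← hφ, vecMulVec_smul, RingHom.id_apply, vecMulVec_smul, map_smul, hφ]) }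
  let Ψ : (ι → K) →ₗ[K] (ι → K) :=
    { toFun := ψ
      map_add' := fun a b => vecMulVec_right_cancel hw₁ (by
        rw [← hψ, add_vecMulVec, add_vecMulVec, map_add, hψ, hψ])
      map_smul' := fun c a => vecMulVec_right_cancel hw₁ (by
        rw [← hψ, smul_vecMulVec, RingHom.id_apply, smul_vecMulVec, map_smul, hψ]) }
  have hΦ : ∀ z, T (vecMulVec x₁ z) = vecMulVec u₁ (Φ z) := hφ
  have hΨ : ∀ x, T (vecMulVec x z₁) = vecMulVec (Ψ x) w₁ := hψ
  have hΦ₁ : Φ z₁ = w₁ := vecMulVec_left_cancel hu₁ (by rw [← hΦ, h₁])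
  have hΨ₁ : Ψ x₁ = u₁ := vecMulVec_right_cancel hw₁ (by rw [← hΨ, h₁])
  have hΦ0 : ∀ {z}, Φ z = 0 → z = 0 := fun {z} h => by
    by_contra hz
    exact (hT0 hx₁ hz (hΦ z)).2 h
  have hΨ0 : ∀ {x}, Ψ x = 0 → x = 0 := fun {x} h => by
    by_contra hx
    exact (hT0 hx hz₁ (hΨ x)).1 h
  refine ⟨Ψ, Φ, fun x z => ?_⟩
  by_cases hx : ∃ c : K, x = c • x₁
  · obtain ⟨c, rfl⟩ := hx
    rw [smul_vecMulVec, map_smul, hΦ, map_smul, hΨ₁, smul_vecMulVec]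
  by_cases hz : ∃ c : K, z = c • z₁
  · obtain ⟨c, rfl⟩ := hz
    rw [vecMulVec_smul, map_smul, hΨ, map_smul, hΦ₁, vecMulVec_smul]
  have hx0 : x ≠ 0 := by rintro rfl; exact hx ⟨0, by simp⟩
  have hz0 : z ≠ 0 := by rintro rfl; exact hz ⟨0, by simp⟩
  have iΨ : ¬ ∃ c : K, Ψ x = c • u₁ := by
    rintro ⟨c, hc⟩
    refine hx ⟨c, sub_eq_zero.1 (hΨ0 ?_)⟩
    rw [map_sub, map_smul, hΨ₁, hc, sub_self]
  have iΦ : ¬ ∃ c : K, Φ z = c • w₁ := by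
    rintro ⟨c, hc⟩
    refine hz ⟨c, sub_eq_zero.1 (hΦ0 ?_)⟩
    rw [map_sub, map_smul, hΦ₁, hc, sub_self]
  obtain ⟨u, w, h⟩ := hrk x z
  obtain ⟨hu, hw⟩ := hT0 hx0 hz0 h
  have d1 : (∃ c : K, u = c • Ψ x) ∨ ∃ c : K, w = c • w₁ := by
    obtain ⟨a, b, hab⟩ := hrk x (z₁ + z)
    rw [vecMulVec_add, map_add, hΨ, h] at hab
    exact dependent_of_vecMulVec_add (fun h0 => hx0 (hΨ0 h0)) hw₁ hab
  have d2 : (∃ c : K, u = c • u₁) ∨ ∃ c : K, w = c • Φ z := by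
    obtain ⟨a, b, hab⟩ := hrk (x₁ + x) z
    rw [add_vecMulVec, map_add, hΦ, h] at hab
    exact dependent_of_vecMulVec_add hu₁ (fun h0 => hz0 (hΦ0 h0)) hab
  rcases d1 with ⟨a, ha⟩ | ⟨b, hb⟩
  · have ha0 : a ≠ 0 := by rintro rfl; exact hu (by rw [ha, zero_smul])
    rcases d2 with ⟨a', ha'⟩ | ⟨b, hb⟩
    · refine absurd ⟨a⁻¹ * a', ?_⟩ iΨ
      rw [mul_smul, ← ha', ha, smul_smul, inv_mul_cancel₀ ha0, one_smul]
    · have hc : T (vecMulVec x z) = (a * b) • vecMulVec (Ψ x) (Φ z) := by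
        rw [h, ha, hb, smul_vecMulVec, vecMulVec_smul, smul_smul]
      -- The scalar `a * b` is pinned to `1` because this fourfold sum must have rank at most one.
      obtain ⟨p, q, hpq⟩ := hrk (x + x₁) (z + z₁)
      rw [add_vecMulVec, vecMulVec_add, vecMulVec_add, map_add, map_add, map_add, hc, hΨ, hΦ,
        h₁] at hpq
      rw [hc, eq_one_of_vecMulVec_add hu₁ hw₁ iΨ iΦ hpq, one_smul]
  · have hb0 : b ≠ 0 := by rintro rfl; exact hw (by rw [hb, zero_smul])
    rcases d2 with ⟨a, ha⟩ | ⟨b', hb'⟩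
    · have h2 : vecMulVec x z = (a * b) • vecMulVec x₁ z₁ := hinj (by
        rw [h, map_smul, h₁, ha, hb, smul_vecMulVec, vecMulVec_smul, smul_smul])
      obtain ⟨k, hk⟩ := Function.ne_iff.1 hz0
      have hk' : z k ≠ 0 := hk
      refine absurd ⟨(z k)⁻¹ * (a * b * z₁ k), ?_⟩ hx
      funext i
      have := congrFun (congrFun h2 i) k
      simp only [vecMulVec_apply, Matrix.smul_apply, smul_eq_mul] at this
      simp only [Pi.smul_apply, smul_eq_mul]
      field_simp
      linear_combination this
    · refine absurd ⟨b'⁻¹ * b, ?_⟩ iΦ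
      have hb0' : b' ≠ 0 := by rintro rfl; exact hw (by rw [hb', zero_smul])
      rw [mul_smul, ← hb, hb', smul_smul, inv_mul_cancel₀ hb0', one_smul]

theorem linearMap_eq_mul_mul [Fintype ι] [Fintype κ] [DecidableEq ι] [DecidableEq κ]
    {ψ : (ι → K) →ₗ[K] (ι → K)} {φ : (κ → K) →ₗ[K] (κ → K)}
    (h : ∀ x z, T (vecMulVec x z) = vecMulVec (ψ x) (φ z)) (A : Matrix ι κ K) :
    T A = LinearMap.toMatrix' ψ * A * (LinearMap.toMatrix' φ)ᵀ := by
  let S : Matrix ι κ K →ₗ[K] Matrix ι κ K :=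
    { toFun := fun A => LinearMap.toMatrix' ψ * A * (LinearMap.toMatrix' φ)ᵀ
      map_add' := fun A B => by rw [Matrix.mul_add, Matrix.add_mul]
      map_smul' := fun c A => by simp }
  suffices T = S from congrArg (fun f : Matrix ι κ K →ₗ[K] Matrix ι κ K => f A) this
  refine Matrix.ext_linearMap K fun i j => LinearMap.ext_ring ?_
  change T (Matrix.single i j (1 : K))
    = LinearMap.toMatrix' ψ * Matrix.single i j (1 : K) * (LinearMap.toMatrix' φ)ᵀ
  rw [single_eq_single_vecMulVec_single, h, mul_vecMulVec, vecMulVec_mul, vecMul_transpose,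
    LinearMap.toMatrix'_mulVec, LinearMap.toMatrix'_mulVec]

end RankOnePreserver

open InnerProductSpace

/-! ### Orthogonality-preserving matrices -/

section Unitary

open Matrix

variable {𝕜 : Type*} [RCLike 𝕜] {ι : Type*} [Fintype ι] [DecidableEq ι]

/-- Orthogonality of basis vectors makes `Pᴴ * P` diagonal, and that of `e i + e i₀` and `e i - e
i₀` makes the diagonal constant. -/
theorem exists_unitary_of_orthogonal [Nonempty ι] {P : Matrix ι ι 𝕜}
    (hinj : ∀ x, P *ᵥ x = 0 → x = 0)
    (h : ∀ x x', x ≠ 0 → x' ≠ 0 → star x ⬝ᵥ x' = 0 → star (P *ᵥ x) ⬝ᵥ (P *ᵥ x') = 0) :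
    ∃ γ : ℝ, 0 < γ ∧ ∃ U ∈ unitaryGroup ι 𝕜, P = (γ : 𝕜) • U := by
  obtain ⟨i₀⟩ := ‹Nonempty ι›
  set e : ι → ι → 𝕜 := fun i => Pi.single i 1 with he
  have hb : ∀ i j, star (P *ᵥ e i) ⬝ᵥ (P *ᵥ e j) = (Pᴴ * P) i j := fun i j => by
    simp [he, Matrix.mul_apply, dotProduct]
  have he0 : ∀ i, e i ≠ 0 := fun i h => by simpa [he] using congrFun h i
  have hoff : ∀ i j, i ≠ j → (Pᴴ * P) i j = 0 := fun i j hij => by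
    rw [← hb]
    exact h _ _ (he0 i) (he0 j) (by simp [he, hij])
  have hdiag : ∀ i, (Pᴴ * P) i i = (Pᴴ * P) i₀ i₀ := by
    intro i
    by_cases hi : i = i₀
    · rw [hi]
    have hi' : i₀ ≠ i := Ne.symm hi
    have h1 := h (e i + e i₀) (e i - e i₀)
      (fun h0 => by simpa [he, Pi.single_apply, hi] using congrFun h0 i)
      (fun h0 => by simpa [he, Pi.single_apply, hi] using congrFun h0 i)
      (by simp [he, dotProduct_sub, hi, hi'])
    rw [mulVec_add, mulVec_sub, star_add, add_dotProduct, dotProduct_sub, dotProduct_sub, hb, hb,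
      hb, hb, hoff _ _ hi, hoff _ _ hi'] at h1
    linear_combination h1
  set s : ℝ := ∑ k, ‖P k i₀‖ ^ 2 with hs
  have hs' : (Pᴴ * P) i₀ i₀ = (s : 𝕜) := by
    rw [Matrix.mul_apply, hs]
    push_cast
    exact Finset.sum_congr rfl fun k _ => by
      rw [conjTranspose_apply, RCLike.star_def, RCLike.conj_mul]
  have hPP : Pᴴ * P = (s : 𝕜) • (1 : Matrix ι ι 𝕜) := by
    ext i j
    by_cases hij : i = j
    · subst hij
      simp [hdiag, hs']
    · simp [hoff i j hij, hij]
  have hs0 : 0 < s := by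
    refine lt_of_le_of_ne (by positivity) fun h0 => he0 i₀ (hinj _ ?_)
    rw [eq_comm, hs, Finset.sum_eq_zero_iff_of_nonneg fun _ _ => by positivity] at h0
    funext k
    simpa [he] using h0 k (Finset.mem_univ k)
  have hγ : ((√s : ℝ) : 𝕜) ≠ 0 := by simpa using (Real.sqrt_pos.2 hs0).ne'
  refine ⟨√s, Real.sqrt_pos.2 hs0, ((√s : ℝ) : 𝕜)⁻¹ • P, ?_, by
    rw [smul_smul, mul_inv_cancel₀ hγ, one_smul]⟩
  rw [mem_unitaryGroup_iff', star_smul, smul_mul_smul_comm, star_eq_conjTranspose, hPP, smul_smul]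
  have : star (((√s : ℝ) : 𝕜)⁻¹) * ((√s : ℝ) : 𝕜)⁻¹ * (s : 𝕜) = 1 := by
    rw [RCLike.star_def, map_inv₀, RCLike.conj_ofReal]
    have h2 : (s : 𝕜) = ((√s : ℝ) : 𝕜) * ((√s : ℝ) : 𝕜) := by
      rw [← RCLike.ofReal_mul, Real.mul_self_sqrt hs0.le]
    rw [h2]
    field_simp
  rw [this, one_smul]

end Unitary

/-! ### Matrices and the equivalence -/

section Matrices

open Matrix

variable {𝕜 : Type*} [RCLike 𝕜] {m n : ℕ}

/-- The matrix version of `PreservesOrthogonalRankOne`. -/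
structure PreservesOrthogonalVecMulVec
    (T : Matrix (Fin m) (Fin n) 𝕜 →ₗ[𝕜] Matrix (Fin m) (Fin n) 𝕜) : Prop where
  injective : Function.Injective T
  exists_eq : ∀ x z, ∃ u w, T (vecMulVec x z) = vecMulVec u w
  orthogonal : ∀ {x x' u u' z z' w w'}, x ≠ 0 → x' ≠ 0 → z ≠ 0 → z' ≠ 0 →
    star x ⬝ᵥ x' = 0 → star z ⬝ᵥ z' = 0 → T (vecMulVec x z) = vecMulVec u w →
    T (vecMulVec x' z') = vecMulVec u' w' → star u ⬝ᵥ u' = 0 ∧ star w ⬝ᵥ w' = 0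

variable {T : Matrix (Fin m) (Fin n) 𝕜 →ₗ[𝕜] Matrix (Fin m) (Fin n) 𝕜}

theorem exists_ne_zero_dotProduct_eq_zero (hm : 2 ≤ m) (x : Fin m → 𝕜) :
    ∃ x' ≠ 0, star x ⬝ᵥ x' = 0 := by
  obtain ⟨z, hz, h⟩ := exists_orthogonal (𝕜 := 𝕜) (F := EuclideanSpace 𝕜 (Fin m)) (by simpa)
    (WithLp.toLp 2 x)
  refine ⟨z.ofLp, by simpa using hz, ?_⟩
  rw [EuclideanSpace.inner_eq_star_dotProduct] at h
  rwa [dotProduct_comm]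

theorem PreservesOrthogonalVecMulVec.exists_unitary (hT : PreservesOrthogonalVecMulVec T)
    (hm : 2 ≤ m) (hn : 2 ≤ n) {x₁ u₁ : Fin m → 𝕜} {z₁ w₁ : Fin n → 𝕜}
    (hx₁ : x₁ ≠ 0) (hz₁ : z₁ ≠ 0) (h₁ : T (vecMulVec x₁ z₁) = vecMulVec u₁ w₁)
    (hrow : ∀ z, ∃ w, T (vecMulVec x₁ z) = vecMulVec u₁ w)
    (hcol : ∀ x, ∃ u, T (vecMulVec x z₁) = vecMulVec u w₁) :
    ∃ U ∈ unitaryGroup (Fin m) 𝕜, ∃ V ∈ unitaryGroup (Fin n) 𝕜, ∃ γ : ℝ, 0 < γ ∧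
      ∀ A, T A = (γ : 𝕜) • (U * A * V) := by
  obtain ⟨ψ, φ, h⟩ := exists_eq_vecMulVec_map hT.injective hT.exists_eq hx₁ hz₁ h₁ hrow hcol
  have : Nonempty (Fin m) := ⟨⟨0, by omega⟩⟩
  have : Nonempty (Fin n) := ⟨⟨0, by omega⟩⟩
  have hne : ∀ {x z}, x ≠ 0 → z ≠ 0 → vecMulVec (ψ x) (φ z) ≠ 0 := fun {x z} hx hz h0 =>
    vecMulVec_ne_zero' hx hz (hT.injective (by rw [h, h0, map_zero]))
  obtain ⟨γ, hγ, U, hU, hPU⟩ := exists_unitary_of_orthogonal (P := LinearMap.toMatrix' ψ)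
    (fun x hx => by
      by_contra hx0
      rw [LinearMap.toMatrix'_mulVec] at hx
      exact hne hx0 hz₁ (by rw [hx]; ext; simp [vecMulVec_apply]))
    (fun x x' hx hx' hxx => by
      obtain ⟨z', hz', hzz⟩ := exists_ne_zero_dotProduct_eq_zero hn z₁
      rw [LinearMap.toMatrix'_mulVec, LinearMap.toMatrix'_mulVec]
      exact (hT.orthogonal hx hx' hz₁ hz' hxx hzz (h _ _) (h _ _)).1)
  obtain ⟨δ, hδ, V, hV, hQV⟩ := exists_unitary_of_orthogonal (P := LinearMap.toMatrix' φ)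
    (fun x hx => by
      by_contra hx0
      rw [LinearMap.toMatrix'_mulVec] at hx
      exact hne hx₁ hx0 (by rw [hx]; ext; simp [vecMulVec_apply]))
    (fun z z' hz hz' hzz => by
      obtain ⟨x', hx', hxx⟩ := exists_ne_zero_dotProduct_eq_zero hm x₁
      rw [LinearMap.toMatrix'_mulVec, LinearMap.toMatrix'_mulVec]
      exact (hT.orthogonal hx₁ hx' hz hz' hxx hzz (h _ _) (h _ _)).2)
  refine ⟨U, hU, Vᵀ, transpose_mem_unitaryGroup_iff.2 hV, γ * δ, by positivity, fun A => ?_⟩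
  rw [linearMap_eq_mul_mul h, hPU, hQV, transpose_smul, Matrix.smul_mul, Matrix.smul_mul,
    Matrix.mul_smul, smul_smul, RCLike.ofReal_mul]

theorem PreservesOrthogonalVecMulVec.finrank_le (hT : PreservesOrthogonalVecMulVec T)
    {x₁ : Fin m → 𝕜} {w₁ : Fin n → 𝕜} (hx₁ : x₁ ≠ 0) (hw₁ : w₁ ≠ 0)
    (hrow : ∀ z, ∃ u, T (vecMulVec x₁ z) = vecMulVec u w₁) : n ≤ m := by
  choose φ hφ using hrow
  let Φ : (Fin n → 𝕜) →ₗ[𝕜] (Fin m → 𝕜) :=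
    { toFun := φ
      map_add' := fun a b => vecMulVec_right_cancel hw₁ (by
        rw [← hφ, vecMulVec_add, add_vecMulVec, map_add, hφ, hφ])
      map_smul' := fun c a => vecMulVec_right_cancel hw₁ (by
        rw [← hφ, vecMulVec_smul, RingHom.id_apply, smul_vecMulVec, map_smul, hφ]) }
  have hΦ : Function.Injective Φ := fun a b hab => by
    have hab' : φ a = φ b := hab
    exact vecMulVec_left_cancel hx₁ (hT.injective (by rw [hφ, hφ, hab']))
  simpa using LinearMap.finrank_le_finrank_of_injective hΦ

theorem PreservesOrthogonalVecMulVec.finrank_ge (hT : PreservesOrthogonalVecMulVec T)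
    {z₁ : Fin n → 𝕜} {u₁ : Fin m → 𝕜} (hz₁ : z₁ ≠ 0) (hu₁ : u₁ ≠ 0)
    (hcol : ∀ x, ∃ w, T (vecMulVec x z₁) = vecMulVec u₁ w) : m ≤ n := by
  choose φ hφ using hcol
  let Φ : (Fin m → 𝕜) →ₗ[𝕜] (Fin n → 𝕜) :=
    { toFun := φ
      map_add' := fun a b => vecMulVec_left_cancel hu₁ (by
        rw [← hφ, vecMulVec_add, add_vecMulVec, map_add, hφ, hφ])
      map_smul' := fun c a => vecMulVec_left_cancel hu₁ (by
        rw [← hφ, vecMulVec_smul, RingHom.id_apply, smul_vecMulVec, map_smul, hφ]) }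
  have hΦ : Function.Injective Φ := fun a b hab => by
    have hab' : φ a = φ b := hab
    exact vecMulVec_right_cancel hz₁ (hT.injective (by rw [hφ, hφ, hab']))
  simpa using LinearMap.finrank_le_finrank_of_injective hΦ

open scoped ComplexOrder in
theorem PreservesOrthogonalVecMulVec.exists_unitary_or (hT : PreservesOrthogonalVecMulVec T)
    (hm : 2 ≤ m) (hn : 2 ≤ n) :
    ∃ U ∈ unitaryGroup (Fin m) 𝕜, ∃ V ∈ unitaryGroup (Fin n) 𝕜, ∃ γ : ℝ, 0 < γ ∧
      ((∀ A, T A = (γ : 𝕜) • (U * A * V)) ∨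
        ∃ h : m = n, ∀ A, T A =
          (γ : 𝕜) • (U * A.transpose.submatrix (Fin.cast h) (Fin.cast h.symm) * V)) := by
  obtain ⟨x₁, hx₁, -⟩ := exists_ne_zero_dotProduct_eq_zero (𝕜 := 𝕜) hm 0
  obtain ⟨z₁, hz₁, -⟩ := exists_ne_zero_dotProduct_eq_zero (𝕜 := 𝕜) hn 0
  obtain ⟨x₂, hx₂, hxx⟩ := exists_ne_zero_dotProduct_eq_zero hm x₁
  obtain ⟨z₂, hz₂, hzz⟩ := exists_ne_zero_dotProduct_eq_zero hn z₁
  have hzz' : star z₂ ⬝ᵥ z₁ = 0 := by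
    rw [star_dotProduct, hzz, star_zero]
  obtain ⟨u₁, w₁, h₁⟩ := hT.exists_eq x₁ z₁
  have hne : ∀ {x z u w}, x ≠ 0 → z ≠ 0 → T (vecMulVec x z) = vecMulVec u w → u ≠ 0 ∧ w ≠ 0 := by
    intro x z u w hx hz h
    constructor <;> rintro rfl <;>
      exact vecMulVec_ne_zero' hx hz (hT.injective (by
        rw [h, map_zero]; ext; simp [vecMulVec_apply]))
  obtain ⟨hu₁, hw₁⟩ := hne hx₁ hz₁ h₁
  rcases row_dichotomy hT.exists_eq hu₁ hw₁ h₁ with hrow | hrow <;>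
    rcases col_dichotomy hT.exists_eq hu₁ hw₁ h₁ with hcol | hcol
  · obtain ⟨U, hU, V, hV, γ, hγ, h⟩ := hT.exists_unitary hm hn hx₁ hz₁ h₁ hrow hcol
    exact ⟨U, hU, V, hV, γ, hγ, Or.inl h⟩
  -- Mixed types are impossible: the images of two orthogonal rank one matrices would share the
  -- factor `u₁`.
  · obtain ⟨w, hw⟩ := hrow z₂
    obtain ⟨w', hw'⟩ := hcol x₂
    have := (hT.orthogonal hx₁ hx₂ hz₂ hz₁ hxx hzz' hw hw').1
    exact absurd (dotProduct_star_self_eq_zero.1 this) hu₁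
  · obtain ⟨w, hw⟩ := hrow z₂
    obtain ⟨w', hw'⟩ := hcol x₂
    have := (hT.orthogonal hx₁ hx₂ hz₂ hz₁ hxx hzz' hw hw').2
    exact absurd (dotProduct_star_self_eq_zero.1 this) hw₁
  · obtain rfl : m = n := le_antisymm (hT.finrank_ge hz₁ hu₁ hcol) (hT.finrank_le hx₁ hw₁ hrow)
    let S : Matrix (Fin m) (Fin m) 𝕜 →ₗ[𝕜] Matrix (Fin m) (Fin m) 𝕜 :=
      T ∘ₗ (transposeLinearEquiv (Fin m) (Fin m) 𝕜 𝕜).toLinearMap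
    have hS : ∀ A, S A = T Aᵀ := fun A => rfl
    have hSv : ∀ x z, S (vecMulVec x z) = T (vecMulVec z x) := fun x z => by
      rw [hS, transpose_vecMulVec]
    have hSp : PreservesOrthogonalVecMulVec S := by
      refine ⟨hT.injective.comp (transposeLinearEquiv (Fin m) (Fin m) 𝕜 𝕜).injective,
        fun x z => by rw [hSv]; exact hT.exists_eq z x, ?_⟩
      intro x x' u u' z z' w w' hx hx' hz hz' hxx hzz e e'
      rw [hSv] at e e'
      exact hT.orthogonal hz hz' hx hx' hzz hxx e e'
    obtain ⟨U, hU, V, hV, γ, hγ, h⟩ := hSp.exists_unitary hm hn hz₁ hx₁ (by rw [hSv, h₁])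
      (fun z => by rw [hSv]; exact hcol z) (fun x => by rw [hSv]; exact hrow x)
    refine ⟨U, hU, V, hV, γ, hγ, Or.inr ⟨rfl, fun A => ?_⟩⟩
    have := h Aᵀ
    rw [hS, transpose_transpose] at this
    exact this

theorem norm_unitary_mul_mul_unitary {U : Matrix (Fin m) (Fin m) 𝕜} {V : Matrix (Fin n) (Fin n) 𝕜}
    (hU : U ∈ unitaryGroup (Fin m) 𝕜) (hV : V ∈ unitaryGroup (Fin n) 𝕜)
    (A : Matrix (Fin m) (Fin n) 𝕜) : ‖U * A * V‖ = ‖A‖ := by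
  rcases isEmpty_or_nonempty (Fin m) with hm | hm
  · rw [Subsingleton.elim (U * A * V) A]
  rcases isEmpty_or_nonempty (Fin n) with hn | hn
  · rw [Subsingleton.elim (U * A * V) A]
  have key : ∀ {U : Matrix (Fin m) (Fin m) 𝕜} {V : Matrix (Fin n) (Fin n) 𝕜}
      (_ : U ∈ unitaryGroup (Fin m) 𝕜) (_ : V ∈ unitaryGroup (Fin n) 𝕜)
      (A : Matrix (Fin m) (Fin n) 𝕜), ‖U * A * V‖ ≤ ‖A‖ := by
    intro U V hU hV A
    refine (l2_opNorm_mul _ _).trans ?_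
    rw [CStarRing.norm_of_mem_unitary hV, mul_one]
    refine (l2_opNorm_mul _ _).trans ?_
    rw [CStarRing.norm_of_mem_unitary hU, one_mul]
  refine le_antisymm (key hU hV A) ?_
  have := key (Unitary.star_mem hU) (Unitary.star_mem hV) (U * A * V)
  rwa [← Matrix.mul_assoc, ← Matrix.mul_assoc, mem_unitaryGroup_iff'.1 hU, Matrix.one_mul,
    Matrix.mul_assoc, mem_unitaryGroup_iff.1 hV, Matrix.mul_one] at this

/-- The transpose is the adjoint of the entrywise conjugate, and conjugation preserves Euclidean
norms. -/
theorem norm_transpose (A : Matrix (Fin m) (Fin n) 𝕜) : ‖Aᵀ‖ = ‖A‖ := by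
  have hstar : ∀ {k : ℕ} (x : Fin k → 𝕜), ‖WithLp.toLp 2 (star x)‖ = ‖WithLp.toLp 2 x‖ :=
    fun x => by simp [EuclideanSpace.norm_eq]
  have key : ∀ B : Matrix (Fin m) (Fin n) 𝕜, ‖B.map star‖ ≤ ‖B‖ := by
    intro B
    rw [l2_opNorm_def]
    refine ContinuousLinearMap.opNorm_le_bound _ (norm_nonneg _) fun x => ?_
    have h1 : (B.map star) *ᵥ x.ofLp = star (B *ᵥ star x.ofLp) := by
      ext i
      simp [mulVec, dotProduct]
    have h2 := l2_opNorm_mulVec B (WithLp.toLp 2 (star x.ofLp))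
    change ‖WithLp.toLp 2 ((B.map star) *ᵥ x.ofLp)‖ ≤ _
    rw [h1, hstar]
    rw [hstar] at h2
    exact h2
  have h2 : ∀ B : Matrix (Fin m) (Fin n) 𝕜, ‖B.map star‖ = ‖B‖ := fun B =>
    le_antisymm (key B) (by
      have := key (B.map star)
      rwa [show (B.map star).map star = B by ext; simp] at this)
  rw [← l2_opNorm_conjTranspose, conjTranspose, transpose_transpose, h2]

/-- Matrices as operators between Euclidean spaces. -/
noncomputable def toOperator : Matrix (Fin m) (Fin n) 𝕜 ≃ₗ[𝕜]
    (EuclideanSpace 𝕜 (Fin n) →L[𝕜] EuclideanSpace 𝕜 (Fin m)) :=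
  (toEuclideanLin (𝕜 := 𝕜)).trans LinearMap.toContinuousLinearMap

theorem norm_toOperator (A : Matrix (Fin m) (Fin n) 𝕜) : ‖toOperator A‖ = ‖A‖ := rfl

theorem norm_toOperator_symm (A : EuclideanSpace 𝕜 (Fin n) →L[𝕜] EuclideanSpace 𝕜 (Fin m)) :
    ‖toOperator.symm A‖ = ‖A‖ := by
  rw [← norm_toOperator, LinearEquiv.apply_symm_apply]

theorem toOperator_vecMulVec (x : Fin m → 𝕜) (z : Fin n → 𝕜) :
    toOperator (vecMulVec x z) = rankOne 𝕜 (WithLp.toLp 2 x) (WithLp.toLp 2 (star z)) := by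
  rw [← LinearEquiv.eq_symm_apply]
  change _ = toEuclideanLin.symm _
  have := symm_toEuclideanLin_rankOne (𝕜 := 𝕜) (WithLp.toLp 2 x) (WithLp.toLp 2 (star z))
  refine Eq.trans ?_ this.symm
  ext i j
  simp [vecMulVec_apply]

/-- The map between spaces of operators corresponding to a map between spaces of matrices. -/
noncomputable def operatorMap (T : Matrix (Fin m) (Fin n) 𝕜 →ₗ[𝕜] Matrix (Fin m) (Fin n) 𝕜) :
    (EuclideanSpace 𝕜 (Fin n) →L[𝕜] EuclideanSpace 𝕜 (Fin m)) →ₗ[𝕜]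
      (EuclideanSpace 𝕜 (Fin n) →L[𝕜] EuclideanSpace 𝕜 (Fin m)) :=
  toOperator.toLinearMap ∘ₗ T ∘ₗ toOperator.symm.toLinearMap

theorem operatorMap_apply (A : EuclideanSpace 𝕜 (Fin n) →L[𝕜] EuclideanSpace 𝕜 (Fin m)) :
    operatorMap T A = toOperator (T (toOperator.symm A)) := rfl

theorem operatorMap_toOperator (A : Matrix (Fin m) (Fin n) 𝕜) :
    operatorMap T (toOperator A) = toOperator (T A) := by
  rw [operatorMap_apply, LinearEquiv.symm_apply_apply]

theorem preservesOrthogonalVecMulVec_of_operatorMap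
    (h : PreservesOrthogonalRankOne (operatorMap T)) : PreservesOrthogonalVecMulVec T := by
  have hR : ∀ x z u w, T (vecMulVec x z) = vecMulVec u w ↔
      operatorMap T (rankOne 𝕜 (WithLp.toLp 2 x) (WithLp.toLp 2 (star z)))
        = rankOne 𝕜 (WithLp.toLp 2 u) (WithLp.toLp 2 (star w)) := by
    intro x z u w
    rw [← toOperator_vecMulVec, ← toOperator_vecMulVec, operatorMap_toOperator]
    exact toOperator.injective.eq_iff.symm
  have hstar : ∀ {k : ℕ} {z z' : Fin k → 𝕜},
      inner 𝕜 (WithLp.toLp 2 (star z)) (WithLp.toLp 2 (star z')) = 0 ↔ star z ⬝ᵥ z' = 0 := by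
    intro k z z'
    rw [EuclideanSpace.inner_eq_star_dotProduct, star_star]
    rw [← star_eq_zero, star_dotProduct, star_star, dotProduct_comm]
  have hnostar : ∀ {k : ℕ} {z z' : Fin k → 𝕜},
      inner 𝕜 (WithLp.toLp 2 z) (WithLp.toLp 2 z') = 0 ↔ star z ⬝ᵥ z' = 0 := by
    intro k z z'
    rw [EuclideanSpace.inner_eq_star_dotProduct, dotProduct_comm]
  have hne : ∀ {k : ℕ} {z : Fin k → 𝕜}, z ≠ 0 → WithLp.toLp 2 z ≠ 0 := fun h => by simpa using h
  refine ⟨fun A B hAB => toOperator.injective (h.injective ?_), fun x z => ?_, ?_⟩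
  · rw [operatorMap_toOperator, operatorMap_toOperator, hAB]
  · obtain ⟨u, v, huv⟩ := h.exists_eq (WithLp.toLp 2 x) (WithLp.toLp 2 (star z))
    exact ⟨u.ofLp, star v.ofLp, (hR _ _ _ _).2 (by rw [huv, star_star])⟩
  · intro x x' u u' z z' w w' hx hx' hz hz' hxx hzz e e'
    have := h.orthogonal (hne hx) (hne hx') (hne (star_ne_zero.2 hz)) (hne (star_ne_zero.2 hz'))
      (hnostar.2 hxx) (hstar.2 hzz) ((hR _ _ _ _).1 e) ((hR _ _ _ _).1 e')
    exact ⟨hnostar.1 this.1, hstar.1 this.2⟩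

theorem three_le_or_of_ne (hm : 2 ≤ m) (hn : 2 ≤ n) (hmn : (m, n) ≠ (2, 2)) :
    3 ≤ Module.finrank 𝕜 (EuclideanSpace 𝕜 (Fin n)) ∨
      3 ≤ Module.finrank 𝕜 (EuclideanSpace 𝕜 (Fin m)) := by
  rw [finrank_euclideanSpace_fin, finrank_euclideanSpace_fin]
  by_contra! h
  exact hmn (by rw [show m = 2 by omega, show n = 2 by omega])

theorem exists_unitary_of_preservesParallel (hm : 2 ≤ m) (hn : 2 ≤ n) (hmn : (m, n) ≠ (2, 2))
    (hT : MatrixPairs.PreservesParallel T) (hrk : 1 < Module.finrank 𝕜 (LinearMap.range T)) :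
    ∃ U ∈ unitaryGroup (Fin m) 𝕜, ∃ V ∈ unitaryGroup (Fin n) 𝕜, ∃ γ : ℝ, 0 < γ ∧
      ((∀ A, T A = (γ : 𝕜) • (U * A * V)) ∨
        ∃ h : m = n, ∀ A, T A =
          (γ : 𝕜) • (U * A.transpose.submatrix (Fin.cast h) (Fin.cast h.symm) * V)) := by
  refine (preservesOrthogonalVecMulVec_of_operatorMap
    (preservesOrthogonalRankOne_of_parallel' (by simpa) (by simpa) (three_le_or_of_ne hm hn hmn)
      ?_ ?_)).exists_unitary_or hm hn
  · rintro A B ⟨μ, hμ, h⟩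
    obtain ⟨ν, hν, h'⟩ := hT (toOperator.symm A) (toOperator.symm B) ⟨μ, hμ, by
      rw [← map_smul, ← map_add, norm_toOperator_symm, norm_toOperator_symm, norm_toOperator_symm,
        h]⟩
    exact ⟨ν, hν, by
      rw [operatorMap_apply, operatorMap_apply, ← map_smul, ← map_add]
      simpa only [norm_toOperator] using h'⟩
  · intro B
    by_contra! h
    have hle : LinearMap.range T ≤ Submodule.span 𝕜 {toOperator.symm B} := by
      rintro _ ⟨A, rfl⟩
      obtain ⟨c, hc⟩ := Submodule.mem_span_singleton.1 (h (toOperator A))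
      rw [operatorMap_toOperator] at hc
      exact Submodule.mem_span_singleton.2 ⟨c, by rw [← map_smul, hc, LinearEquiv.symm_apply_apply]⟩
    have h1 := Submodule.finrank_mono hle
    have h2 := finrank_span_le_card (R := 𝕜) {toOperator.symm B}
    rw [Set.toFinset_singleton, Finset.card_singleton] at h2
    omega

theorem preservesParallel_of_preservesTEA (hT : MatrixPairs.PreservesTEA T) :
    MatrixPairs.PreservesParallel T := by
  rintro A B ⟨μ, hμ, h⟩
  have h1 : ∀ C : Matrix (Fin m) (Fin n) 𝕜, ‖μ • C‖ = ‖C‖ := fun C => by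
    rw [norm_smul, hμ, one_mul]
  have := hT A (μ • B) (by rw [MatrixPairs.IsTEA, h, h1])
  rw [MatrixPairs.IsTEA, map_smul, h1] at this
  exact ⟨μ, hμ, this⟩

/-- If the range were a line, `T` would be a functional times a fixed matrix, and that functional
would preserve triangle equality. -/
theorem one_lt_finrank_range_of_preservesTEA (hm : 2 ≤ m) (hn : 2 ≤ n) (hmn : (m, n) ≠ (2, 2))
    (hT0 : T ≠ 0) (hT : MatrixPairs.PreservesTEA T) :
    1 < Module.finrank 𝕜 (LinearMap.range T) := by
  by_contra! hle
  obtain ⟨⟨B, hBr⟩, hB⟩ := finrank_le_one_iff.1 hle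
  have hc : ∀ A, ∃ c : 𝕜, T A = c • B := fun A => by
    obtain ⟨c, hc⟩ := hB ⟨T A, A, rfl⟩
    exact ⟨c, (congrArg Subtype.val hc).symm⟩
  have hB0 : B ≠ 0 := by
    rintro rfl
    refine hT0 (LinearMap.ext fun A => ?_)
    obtain ⟨c, hc⟩ := hc A
    rw [hc, smul_zero]; rfl
  obtain ⟨i, j, hij⟩ : ∃ i j, B i j ≠ 0 := by
    by_contra! h
    exact hB0 (by ext i j; exact h i j)
  let g : Matrix (Fin m) (Fin n) 𝕜 →ₗ[𝕜] 𝕜 :=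
    { toFun := fun A => (B i j)⁻¹ * T A i j
      map_add' := fun A C => by simp [mul_add]
      map_smul' := fun c A => by simp; ring }
  have hg : ∀ A, T A = g A • B := fun A => by
    obtain ⟨c, hc⟩ := hc A
    have : g A = c := by
      change (B i j)⁻¹ * T A i j = c
      rw [hc, Matrix.smul_apply, smul_eq_mul]
      field_simp
    rw [this, hc]
  have hBn : ‖B‖ ≠ 0 := norm_ne_zero_iff.2 hB0
  have h0 := eq_zero_of_norm_add' (by simpa) (by simpa) (three_le_or_of_ne (𝕜 := 𝕜) hm hn hmn)
    (g ∘ₗ toOperator.symm.toLinearMap) (fun A C hAC => by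
      have := hT (toOperator.symm A) (toOperator.symm C) (by
        rw [MatrixPairs.IsTEA, ← map_add, norm_toOperator_symm, norm_toOperator_symm,
          norm_toOperator_symm, hAC])
      rw [MatrixPairs.IsTEA, hg, hg, ← add_smul, norm_smul, norm_smul, norm_smul, ← add_mul] at this
      exact mul_right_cancel₀ hBn this)
  refine hT0 (LinearMap.ext fun A => ?_)
  have := congrArg (fun f => f (toOperator A)) h0
  simp only [LinearMap.comp_apply, LinearEquiv.coe_coe, LinearEquiv.symm_apply_apply,
    LinearMap.zero_apply] at this
  rw [hg, this, zero_smul]; rfl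

theorem preservesTEA_of_norm_eq {γ : ℝ} (h : ∀ A, ‖T A‖ = γ * ‖A‖) :
    MatrixPairs.PreservesTEA T := by
  intro A B hAB
  rw [MatrixPairs.IsTEA, ← map_add, h, h, h, hAB, mul_add]

theorem preservesTEA_of_unitary
    (h : ∃ U ∈ unitaryGroup (Fin m) 𝕜, ∃ V ∈ unitaryGroup (Fin n) 𝕜, ∃ γ : ℝ, 0 < γ ∧
      ((∀ A, T A = (γ : 𝕜) • (U * A * V)) ∨
        ∃ h : m = n, ∀ A, T A =
          (γ : 𝕜) • (U * A.transpose.submatrix (Fin.cast h) (Fin.cast h.symm) * V))) :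
    MatrixPairs.PreservesTEA T := by
  obtain ⟨U, hU, V, hV, γ, hγ, h⟩ := h
  refine preservesTEA_of_norm_eq (γ := γ) fun A => ?_
  rcases h with h | ⟨rfl, h⟩
  · rw [h, norm_smul, RCLike.norm_ofReal, abs_of_pos hγ, norm_unitary_mul_mul_unitary hU hV]
  · rw [h, norm_smul, RCLike.norm_ofReal, abs_of_pos hγ, norm_unitary_mul_mul_unitary hU hV,
      ← norm_transpose A]
    rfl

end Matrices

end ParallelPairs

theorem theorem1p1 {𝕜 : Type*} [RCLike 𝕜] (m n : ℕ) (hm : 2 ≤ m) (hn : 2 ≤ n)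
    (hmn : (m, n) ≠ (2, 2))
    (T : Matrix (Fin m) (Fin n) 𝕜 →ₗ[𝕜] Matrix (Fin m) (Fin n) 𝕜) (hT : T ≠ 0) :
    List.TFAE [
      MatrixPairs.PreservesTEA T,
      MatrixPairs.PreservesParallel T ∧ 1 < Module.finrank 𝕜 (LinearMap.range T),
      ∃ U ∈ Matrix.unitaryGroup (Fin m) 𝕜, ∃ V ∈ Matrix.unitaryGroup (Fin n) 𝕜,
        ∃ γ : ℝ, 0 < γ ∧
          ((∀ A, T A = (γ : 𝕜) • (U * A * V)) ∨
            ∃ h : m = n, ∀ A, T A =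
              (γ : 𝕜) • (U * A.transpose.submatrix (Fin.cast h) (Fin.cast h.symm) * V))] := by
  tfae_have 1 → 2 := fun h => ⟨ParallelPairs.preservesParallel_of_preservesTEA h,
    ParallelPairs.one_lt_finrank_range_of_preservesTEA hm hn hmn hT h⟩
  tfae_have 2 → 3 := fun h =>
    ParallelPairs.exists_unitary_of_preservesParallel hm hn hmn h.1 h.2
  tfae_have 3 → 1 := ParallelPairs.preservesTEA_of_unitary
  tfae_finish
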